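/- **Model.** A classical computation with running time $T$ and space $S$ on $q$ input bits is a straight-line Boolean program of at most $T$ steps with $S$ memory bits, initially $0$; each step overwrites one memory bit by an arbitrary Boolean function of two bits, each a (read-only) input bit or a memory bit. It computes $f:\{0,1\}^q\to\{0,1\}^r$ if on every input $x$ the bits of $f(x)$ are the final contents of $r$ fixed, distinct memory cells. A quantum circuit is a sequence of operations, each counted as one gate: $X$, $Z$, Hadamard, CNOT and Toffoli gates, single-qubit measurements in the computational basis whose outcome is written to a classical bit, and gates applied if and only if a given classical bit is $1$. It *simulates $f$ on quantum inputs* if for all amplitudes $(\alpha_x)$ and all measurement outcomes it maps $\sum_x\alpha_x|x\rangle|0\rangle$ (classical bits $0$) to $\sum_x\alpha_x|x\rangle|f(x)\rangle|0\rangle$, up to a scalar depending only on the outcomes. The *spooky pebble game* on the line $0\to1\to\dots\to n$ starts with a pebble on $0$ only. On each vertex $i\in\{1,\dots,n\}$ one may turn a pebble into a ghost at any time, and may, if $i-1$ carries a pebble, put a pebble on $i$ (replacing a ghost if there is one) or remove a pebble from $i$. A *spooky pebbling* of the line is a sequence of such moves after which there are pebbles on $0$ and $n$ only and no ghosts; it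 uses $p$ pebbles if at most $p$ of the vertices $1,\dots,n$ carry pebbles at any time. Let $n=\lceil T/S\rceil$, let the value of vertex $i<n$ be the memory after the first $iS$ steps of the program, and let the value of vertex $n$ be the final memory with the non-output cells set to $0$. A circuit *carries out* a spooky pebbling of this line *by measurement-based uncomputation* if it splits into consecutive blocks, one for each move, such that after each move, for all amplitudes and outcomes and up to a scalar depending only on the outcomes, the state is $\sum_x\alpha_x\,\theta(x)\,|x\rangle\otimes|\cdot\rangle$. Here the value on input $x$ of each pebbled vertex $i\geq1$ is held in its own register of $S$ qubits, all other non-input qubits are $0$, and $\theta(x)=\prod_{i}(-1)^{\beta_i\cdot v_i(x)}$, where $i$ runs over the ghosted vertices, $v_i(x)\in\{0,1\}^S$ is the value of $i$, and $\beta_i\in\{0,1\}^S$ is the content of a classical register assigned to $i$. **Statement.** There is a universal constant $C>0$ such that for every $\varepsilon\in(0,1)$, with $s=\lceil1/\varepsilon\rceil$, the following holds. For every $n\ge1$ there is a spooky pebbling $P_n$ of the line of length $n$ that uses $s+2$ pebbles and at most $C\,s\,n^{1+1/s}$ moves, and the family $(P_n)$ can be chosen such that for all integers $1\le S\le T$,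 every $f:\{0,1\}^q\to\{0,1\}^r$ and every classical computation of $f$ with running time $T$ and space $S$, there is a quantum circuit that carries out $P_{\lceil T/S\rceil}$ by measurement-based uncomputation, simulates $f$ on quantum inputs, and has at most $$C\,\frac1\varepsilon\,\frac{T^{1+\varepsilon}}{S^{\varepsilon}}\ \text{gates},\qquad q+C\,\frac1\varepsilon\,S\ \text{qubits (the $q$ input qubits and at most $C\,\tfrac1\varepsilon\,S$ others, including the output)},\qquad C\,T\ \text{classical bits}.$$ In particular, if $q\le S$ there are $O(\frac1\varepsilon S)$ qubits in total. -/

import Mathlib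

noncomputable section

namespace SpookySim

/-! ### Classical computations

A computation on `q` read-only input bits with `S` bits of memory is a straight-line Boolean
program.  One step overwrites one bit of memory by an arbitrary Boolean function of two bits, each
of which is an input bit or a memory bit.  The memory is initially zero. -/

/-- One elementary step of a classical computation. -/
structure Instr (q S : ℕ) where
  target : Fin S
  left : Fin q ⊕ Fin S
  right : Fin q ⊕ Fin S
  op : Bool → Bool → Bool

/-- The memory after one step, on input `x` and with memory `mem` before the step. -/
def Instr.exec {q S : ℕ} (c : Instr q S) (x : Fin q → Bool) (mem : Fin S → Bool) : Fin S → Bool :=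
  Function.update mem c.target (c.op (Sum.elim x mem c.left) (Sum.elim x mem c.right))

/-- A classical computation: its running time is the length of the list, its space is `S`. -/
abbrev Program (q S : ℕ) := List (Instr q S)

/-- The memory after the run of the program on input `x`. -/
def Program.memory {q S : ℕ} (prog : Program q S) (x : Fin q → Bool) : Fin S → Bool :=
  prog.foldl (fun mem c => c.exec x mem) (fun _ => false)

/-- The program computes `f`, the output being left in the memory cells `out 0, …, out (r - 1)`. -/
def Program.Computes {q r S : ℕ} (prog : Program q S) (out : Fin r ↪ Fin S)
    (f : (Fin q → Bool) → (Fin r → Bool)) : Prop :=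
  ∀ x j, prog.memory x (out j) = f x j

/-! ### Quantum circuits with measurements and classical control -/

section Quantum

variable {W B : Type} [DecidableEq W] [DecidableEq B]

/-- The unitary gates, on qubits indexed by `W`: Pauli `X` and `Z`, Hadamard, controlled NOT and
Toffoli (the last argument that is a qubit is the target). -/
inductive Gate (W : Type) where
  | X (t : W)
  | Z (t : W)
  | H (t : W)
  | CNOT (c t : W) (hct : c ≠ t)
  | CCNOT (c d t : W) (hcd : c ≠ d) (hct : c ≠ t) (hdt : d ≠ t)

/-- A (not necessarily normalized) vector of amplitudes over the computational basis. -/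
abbrev QState (W : Type) := (W → Bool) → ℂ

/-- The action of a gate on amplitudes.  The permutations of the basis given by `X`, `CNOT` and
`CCNOT` are involutions, so they may be written on the argument. -/
def Gate.apply : Gate W → QState W → QState W
  | .X t, ψ => fun y => ψ (Function.update y t (!y t))
  | .Z t, ψ => fun y => (if y t then -1 else 1) * ψ y
  | .H t, ψ => fun y => ((1 / √2 : ℝ) : ℂ) *
      (ψ (Function.update y t false) + (if y t then -1 else 1) * ψ (Function.update y t true))
  | .CNOT c t _, ψ => fun y => ψ (Function.update y t (xor (y t) (y c)))
  | .CCNOT c d t _ _ _, ψ => fun y => ψ (Function.update y t (xor (y t) (y c && y d)))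

/-- The elementary operations of a circuit: a gate, the measurement of a qubit in the computational
basis with the outcome written to a classical bit, and a gate that is applied if and only if a
classical bit is `1`. -/
inductive Op (W B : Type) where
  | gate (g : Gate W)
  | measure (w : W) (b : B)
  | control (b : B) (g : Gate W)

/-- A circuit; each operation counts as one gate. -/
abbrev Circuit (W B : Type) := List (Op W B)

/-- The joint state in one branch of a computation: the unnormalized amplitudes, whose squared norm
is the probability of the branch, and the contents of the classical bits. -/
structure Branch (W B : Type) where
  amp : QState W
  bits : B → Bool

/-- One operation; `o` is the outcome if the operation is a measurement, and is ignored if not. -/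
def Op.exec (o : Bool) : Op W B → Branch W B → Branch W B
  | .gate g, s => ⟨g.apply s.amp, s.bits⟩
  | .measure w b, s => ⟨fun y => if y w = o then s.amp y else 0, Function.update s.bits b o⟩
  | .control b g, s => ⟨if s.bits b then g.apply s.amp else s.amp, s.bits⟩

/-- The branch of the run in which the operation at time `t`, if it is a measurement, has outcome
`ω t`.  The second argument is the time at which the run starts. -/
def Circuit.run (ω : ℕ → Bool) : ℕ → Circuit W B → Branch W B → Branch W B
  | _, [], s => s
  | t, op :: ops, s => Circuit.run ω (t + 1) ops (op.exec (ω t) s)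

/-- The basis vector `|y⟩`. -/
def ket (y : W → Bool) : QState W :=
  open Classical in
  fun y' => if y' = y then 1 else 0

end Quantum

/-- The initial state `∑ x, α x |x⟩ |0⟩` on `q` input qubits and `a` further qubits, all classical
bits being zero. -/
def initial {q a b : ℕ} (α : (Fin q → Bool) → ℂ) : Branch (Fin q ⊕ Fin a) (Fin b) where
  amp := ∑ x : Fin q → Bool, α x • ket (Sum.elim x (fun _ => false))
  bits := fun _ => false

/-- The circuit maps `∑ x, α x |x⟩ |0⟩` to `∑ x, α x |x⟩ |f x⟩ |0⟩` for all amplitudes `α`, whatever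
the outcomes of the measurements.  The factor `z` of a branch does not depend on `α`; its squared
absolute value is the probability of the branch.  The value `f x` is in the qubits `o`, and all
other qubits except the inputs are returned to zero. -/
def Simulates {q r a b : ℕ} (circ : Circuit (Fin q ⊕ Fin a) (Fin b))
    (f : (Fin q → Bool) → (Fin r → Bool)) : Prop :=
  ∃ o : Fin r ↪ Fin a, ∀ ω : ℕ → Bool, ∃ z : ℂ, ∀ α : (Fin q → Bool) → ℂ,
    (Circuit.run ω 0 circ (initial α)).amp =
      z • ∑ x : Fin q → Bool,
        α x • ket (Sum.elim x (fun w => decide (∃ j, o j = w ∧ f x j = true)))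

/-! ### The spooky pebble game on the line with vertices `0, …, n` and edges `i → i + 1` -/

/-- The content of a vertex. -/
inductive Cell where
  | empty
  | pebble
  | ghost
  deriving DecidableEq

/-- The moves; each acts on the vertex given. -/
inductive Move where
  | ghost (i : ℕ)
  | place (i : ℕ)
  | remove (i : ℕ)

/-- The effect of a move. -/
def Move.apply (c : ℕ → Cell) : Move → (ℕ → Cell)
  | .ghost i => Function.update c i .ghost
  | .place i => Function.update c i .pebble
  | .remove i => Function.update c i .empty

/-- The rules: a pebble may be turned into a ghost; a pebble may be put on a vertex (replacing a
ghost if there is one), or removed from it, if there is a pebble on the preceding vertex.  All moves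
act on the vertices `1, …, n`. -/
def Move.Legal (n : ℕ) (c : ℕ → Cell) : Move → Prop
  | .ghost i => 1 ≤ i ∧ i ≤ n ∧ c i = .pebble
  | .place i => 1 ≤ i ∧ i ≤ n ∧ c i ≠ .pebble ∧ c (i - 1) = .pebble
  | .remove i => 1 ≤ i ∧ i ≤ n ∧ c i = .pebble ∧ c (i - 1) = .pebble

/-- The initial position: one pebble, on the vertex `0`. -/
def start : ℕ → Cell := Function.update (fun _ => .empty) 0 .pebble

/-- The position after the first `j` moves. -/
def position (moves : List Move) (j : ℕ) : ℕ → Cell :=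
  (moves.take j).foldl Move.apply start

/-- The sequence of moves is legal, starts with a pebble on `0` only, ends with pebbles on `0` and
`n` only and no ghosts, and never has more than `p` pebbles on the vertices `1, …, n`. -/
def SpookyPebbles (n p : ℕ) (moves : List Move) : Prop :=
  (∀ (j : ℕ) (hj : j < moves.length), moves[j].Legal n (position moves j)) ∧
  position moves moves.length = Function.update start n .pebble ∧
  ∀ j ≤ moves.length, ((Finset.Icc 1 n).filter (fun i => position moves j i = .pebble)).card ≤ p

/-! ### Circuits that carry out a spooky pebbling -/

/-- The `S` bits that the vertex `i` of the line of length `n` stands for: the memory after `i * S`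
steps of the program, where the last vertex carries only the output cells. -/
def vertexValue {q r S : ℕ} (prog : Program q S) (out : Fin r ↪ Fin S) (n i : ℕ)
    (x : Fin q → Bool) (k : Fin S) : Bool :=
  Program.memory (prog.take (i * S)) x k && decide (i = n → ∃ j, out j = k)

/-- The basis state in which the input qubits hold `x`, the register `reg i` of each pebbled vertex
`i` (with `1 ≤ i ≤ n`) holds the value of the vertex, and all other qubits are zero. -/
def pebbledBits {q r S a : ℕ} (prog : Program q S) (out : Fin r ↪ Fin S) (n : ℕ)
    (c : ℕ → Cell) (reg : ℕ → Fin S → Fin a) (x : Fin q → Bool) : Fin q ⊕ Fin a → Bool :=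
  open Classical in
  Sum.elim x (fun w => decide (∃ i k, 1 ≤ i ∧ i ≤ n ∧ c i = .pebble ∧ reg i k = w ∧
    vertexValue prog out n i x k = true))

/-- The phase due to the ghosts: each ghosted vertex `i` contributes `(-1) ^ (β · v)`, where `v` is
the value of the vertex and `β` the measured bits kept in the classical register `creg i`. -/
def ghostPhase {q r S b : ℕ} (prog : Program q S) (out : Fin r ↪ Fin S) (n : ℕ)
    (c : ℕ → Cell) (creg : ℕ → Fin S → Fin b) (bits : Fin b → Bool) (x : Fin q → Bool) : ℂ :=
  ∏ i ∈ (Finset.Icc 1 n).filter (fun i => c i = .ghost), ∏ k : Fin S,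
    if bits (creg i k) && vertexValue prog out n i x k then -1 else 1

/-- The circuit with the given consecutive blocks carries out the moves by measurement-based
uncomputation, one block for each move: whatever the outcomes of the measurements, after each move
the value of each pebbled vertex is held in a register of `S` qubits of its own, each ghost is
present as a phase determined by measured classical bits, and all other non-input qubits are zero.
The register of a vertex may change with the time `j`. -/
def CarriesOut {q r S a b : ℕ} (blocks : List (Circuit (Fin q ⊕ Fin a) (Fin b)))
    (prog : Program q S) (out : Fin r ↪ Fin S) (n : ℕ) (moves : List Move) : Prop :=
  blocks.length = moves.length ∧
  ∃ (reg : ℕ → ℕ → Fin S → Fin a) (creg : ℕ → Fin S → Fin b), ∀ j ≤ moves.length,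
    (∀ i i' k k', 1 ≤ i → i ≤ n → 1 ≤ i' → i' ≤ n →
      position moves j i = .pebble → position moves j i' = .pebble →
      reg j i k = reg j i' k' → i = i' ∧ k = k') ∧
    ∀ ω : ℕ → Bool, ∃ z : ℂ, ∀ α : (Fin q → Bool) → ℂ,
      (Circuit.run ω 0 (blocks.take j).flatten (initial α)).amp =
        z • ∑ x : Fin q → Bool,
          (α x * ghostPhase prog out n (position moves j) creg
            (Circuit.run ω 0 (blocks.take j).flatten (initial α)).bits x) •
          ket (pebbledBits prog out n (position moves j) (reg j) x)

end SpookySim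

end

namespace SpookySim

/-! ### Pebbling the line -/

/-! Cut the program into n pieces of S steps, so that a move of the pebble game becomes a circuit of
at most 10S gates, and the theorem splits into a pebbling strategy and a simulation of single moves.

Strategy. A pebble can walk any distance with only two pebbles in play, leaving ghosts behind
(`reach_walked`). After a walk from 0 to n the ghosts on the vertices between must go.
`reach_cleared` does this by recursion on the number k of spare pebbles: a segment of length at most
m^k is cut into at most m blocks of length at most m^(k-1), cleared from the far end. For each block
but the one nearest the base, a pebble walks to just before the block, serves as the base from which
the block is cleared with one spare pebble fewer, and is then ghosted. The walks of one level cost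
at most 2m moves per vertex, so s levels with m = ⌈n^(1/s)⌉ give O(s n^(1+1/s)) moves, with s + 1
working pebbles and one on n.

Simulation. The outcomes fix the classical bits independently of the amplitudes, and each branch
acts linearly, so it suffices to follow basis states as long as the measured bits are common to all
inputs (`Circuit.run_sum`). Computing a piece into scratch qubits, copying the result and undoing
the computation XORs the value of vertex i into a register (`exists_gates_xor`): the same map places
a pebble on an empty vertex and removes one. Ghosting measures the register in the Hadamard basis,
which leaves the sign (-1)^(β·v). Once v has been recomputed, controlled Z gates cancel that sign
(`exists_implements_place`).

Registers are reused: beyond those of the pebbled vertices, one serves as scratch and one stands for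
the zero memory of vertex 0, so p pebbles fit into p + 3 registers. The number of moves, with n =
⌈T/S⌉ and s = ⌈1/ε⌉, turns into the gate count in `gate_bound`. -/

/-- The number of pebbles on the vertices `1, …, n`. -/
def pebbleCount (n : ℕ) (c : ℕ → Cell) : ℕ :=
  ((Finset.Icc 1 n).filter (fun i => c i = .pebble)).card

/-- The moves are legal from the position `c` on, with at most `p` pebbles after each of them. -/
def Play (n p : ℕ) : (ℕ → Cell) → List Move → Prop
  | _, [] => True
  | c, m :: ms => m.Legal n c ∧ pebbleCount n (m.apply c) ≤ p ∧ Play n p (m.apply c) ms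

/-- The position `c'` can be reached from `c` by at most `N` moves with at most `p` pebbles. -/
def Reach (n p N : ℕ) (c c' : ℕ → Cell) : Prop :=
  ∃ ms : List Move, Play n p c ms ∧ ms.foldl Move.apply c = c' ∧ ms.length ≤ N

lemma Play.append {n p : ℕ} {ms ms' : List Move} {c : ℕ → Cell} (h : Play n p c ms)
    (h' : Play n p (ms.foldl Move.apply c) ms') : Play n p c (ms ++ ms') := by
  induction ms generalizing c with
  | nil => exact h'
  | cons m ms ih => exact ⟨h.1, h.2.1, ih h.2.2 h'⟩

lemma Play.spookyPebbles_aux {n p : ℕ} {ms : List Move} {c : ℕ → Cell} (h : Play n p c ms)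
    (hc : pebbleCount n c ≤ p) :
    (∀ (j : ℕ) (hj : j < ms.length), ms[j].Legal n ((ms.take j).foldl Move.apply c)) ∧
    ∀ j ≤ ms.length, pebbleCount n ((ms.take j).foldl Move.apply c) ≤ p := by
  induction ms generalizing c with
  | nil => exact ⟨fun j hj => by simp at hj, fun j _ => by simpa using hc⟩
  | cons m ms ih =>
    obtain ⟨h1, h2⟩ := ih h.2.2 h.2.1
    constructor
    · rintro (_ | j) hj
      · exact h.1
      · exact h1 j (by simpa using hj)
    · rintro (_ | j) hj
      · exact hc
      · exact h2 j (by simpa using hj)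

lemma Reach.refl (n p : ℕ) (c : ℕ → Cell) : Reach n p 0 c c := ⟨[], trivial, rfl, le_rfl⟩

lemma Reach.mono {n p N N' : ℕ} {c c' : ℕ → Cell} (h : Reach n p N c c') (hN : N ≤ N') :
    Reach n p N' c c' := by
  obtain ⟨ms, h1, h2, h3⟩ := h
  exact ⟨ms, h1, h2, h3.trans hN⟩

lemma Reach.trans {n p N N' : ℕ} {c c' c'' : ℕ → Cell} (h : Reach n p N c c')
    (h' : Reach n p N' c' c'') : Reach n p (N + N') c c'' := by
  obtain ⟨ms, h1, rfl, h3⟩ := h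
  obtain ⟨ms', h1', rfl, h3'⟩ := h'
  exact ⟨ms ++ ms', h1.append h1', by simp, by simp; omega⟩

lemma Reach.single {n p : ℕ} {c c' : ℕ → Cell} (m : Move) (hm : m.Legal n c)
    (hc : m.apply c = c') (hp : pebbleCount n c' ≤ p) : Reach n p 1 c c' :=
  ⟨[m], ⟨hm, hc ▸ hp, trivial⟩, hc, le_rfl⟩

lemma pebbleCount_le_add_one {n : ℕ} {c c' : ℕ → Cell} (v : ℕ)
    (h : ∀ i, i ≠ v → c' i = .pebble → c i = .pebble) :
    pebbleCount n c' ≤ pebbleCount n c + 1 := by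
  refine (Finset.card_le_card ?_).trans (Finset.card_insert_le v _)
  intro i hi
  simp only [Finset.mem_filter, Finset.mem_insert] at hi ⊢
  by_cases hv : i = v
  · exact Or.inl hv
  · exact Or.inr ⟨hi.1, h i hv hi.2⟩

lemma pebbleCount_mono {n : ℕ} {c c' : ℕ → Cell} (h : ∀ i, c' i = .pebble → c i = .pebble) :
    pebbleCount n c' ≤ pebbleCount n c :=
  Finset.card_le_card (Finset.monotone_filter_right _ fun i _ => h i)

lemma pebbleCount_start (n : ℕ) : pebbleCount n start = 0 := by
  simp only [pebbleCount, Finset.card_eq_zero, Finset.filter_eq_empty_iff, Finset.mem_Icc]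
  intro i hi
  rw [start, Function.update_of_ne (by omega)]
  simp

/-! ### The strategy: walking and recursive clearing -/

/-- The position after a pebble was moved from `a` to `a + l + 1`, leaving ghosts behind. -/
def walked (c : ℕ → Cell) (a l : ℕ) : ℕ → Cell := fun i =>
  if a < i ∧ i ≤ a + l then .ghost else if i = a + l + 1 then .pebble else c i

/-- The position with the vertices `a + 1, …, a + l` made empty. -/
def cleared (c : ℕ → Cell) (a l : ℕ) : ℕ → Cell := fun i =>
  if a < i ∧ i ≤ a + l then .empty else c i

lemma pebbleCount_walked (n : ℕ) (c : ℕ → Cell) (a l : ℕ) :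
    pebbleCount n (walked c a l) ≤ pebbleCount n c + 1 := by
  refine pebbleCount_le_add_one (a + l + 1) fun i hi h => ?_
  simp only [walked, hi, if_false] at h
  split_ifs at h
  exact h

/-- Place on the next vertex, then ghost the one behind: two moves per step, and the second pebble
is needed only between these moves. -/
lemma reach_walked {n p a l : ℕ} {c : ℕ → Cell} (ha : c a = .pebble)
    (hc : ∀ i, a < i → i ≤ a + l + 1 → c i ≠ .pebble) (hn : a + l + 1 ≤ n)
    (hp : pebbleCount n c + 2 ≤ p) : Reach n p (2 * l + 1) c (walked c a l) := by
  induction l with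
  | zero =>
    refine Reach.single (.place (a + 1)) ⟨by omega, by omega, hc _ (by omega) (by omega), ha⟩ ?_
      ((pebbleCount_walked _ _ _ _).trans (by omega))
    funext i
    simp only [Move.apply, walked, Function.update_apply]
    grind
  | succ l ih =>
    have h1 := ih (fun i hi hi' => hc i hi (by omega)) (by omega)
    have hw := pebbleCount_walked n c a l
    refine ((h1.trans (Reach.single (.place (a + l + 2)) ⟨by omega, by omega, ?_, ?_⟩ rfl ?_)).trans
      (Reach.single (.ghost (a + l + 1)) ⟨by omega, by omega, ?_⟩ ?_
        ((pebbleCount_walked _ _ _ _).trans (by omega)))).mono (by omega)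
    · have := hc (a + l + 2) (by omega) (by omega)
      simp only [walked]; grind
    · simp [walked]
    · refine (pebbleCount_le_add_one (c := walked c a l) (a + l + 2) fun i hi h => ?_).trans
        (by omega)
      simpa [Move.apply, hi] using h
    · simp [Move.apply, walked]
    · funext i
      simp only [Move.apply, walked, Function.update_apply]
      grind

/-- With one spare pebble a single vertex is cleared by placing and then removing. Each further
spare pebble multiplies the reach by m: it acts as a temporary base from which far blocks are
cleared, at the price of 2m moves per vertex for walking. -/
lemma reach_cleared {n p m : ℕ} (k : ℕ) {a l : ℕ} {c : ℕ → Cell} (ha : c a = .pebble)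
    (hc : ∀ i, a < i → i ≤ a + l → c i ≠ .pebble) (hn : a + l ≤ n) (hl : l ≤ m ^ k)
    (hp : pebbleCount n c + k + 1 ≤ p) :
    Reach n p ((2 * k * m + 2) * l) c (cleared c a l) := by
  induction k generalizing a l c with
  | zero =>
    have hl' : l = 0 ∨ l = 1 := by rw [pow_zero] at hl; omega
    rcases hl' with rfl | rfl
    · have : cleared c a 0 = c := by funext i; simp only [cleared]; grind
      rw [this]; exact (Reach.refl n p c).mono (by omega)
    · refine ((Reach.single (.place (a + 1))
        ⟨by omega, by omega, hc _ (by omega) (by omega), ha⟩ rfl ?_).trans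
        (Reach.single (.remove (a + 1)) ⟨by omega, by omega, ?_, ?_⟩ ?_ ?_)).mono (by omega)
      · refine (pebbleCount_le_add_one (c := c) (a + 1) fun i hi h => ?_).trans (by omega)
        simpa [Move.apply, hi] using h
      · simp [Move.apply]
      · simpa [Move.apply] using ha
      · funext i
        simp only [Move.apply, cleared, Function.update_apply]
        grind
      · refine (pebbleCount_mono (c := c) fun i h => ?_).trans (by omega)
        simp only [cleared] at h; grind
  | succ k ih =>
    -- Here j bounds the number of blocks of length m^k still to be cleared. The term 2jl pays for
    -- the walks, and the other term for clearing every block once at the lower level.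
    have key : ∀ (j l : ℕ) (c : ℕ → Cell), c a = .pebble →
        (∀ i, a < i → i ≤ a + l → c i ≠ .pebble) → a + l ≤ n → l ≤ j * m ^ k →
        pebbleCount n c + k + 2 ≤ p →
        Reach n p (2 * j * l + (2 * k * m + 2) * l) c (cleared c a l) := by
      intro j
      induction j with
      | zero =>
        intro l c ha hc hn hl hp
        obtain rfl : l = 0 := by simpa using hl
        have : cleared c a 0 = c := by funext i; simp only [cleared]; grind
        rw [this]; exact (Reach.refl n p c).mono (by omega)
      | succ j ihj =>
        intro l c ha hc hn hl hp
        by_cases hlm : l ≤ m ^ k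
        · exact (ih ha hc hn hlm (by omega)).mono (Nat.le_add_left _ _)
        -- The far block of m^k vertices is split off; its base is the vertex a + l' + 1, which is
        -- itself part of what remains to be cleared.
        · obtain ⟨l', rfl⟩ : ∃ l', l = l' + 1 + m ^ k := ⟨l - m ^ k - 1, by omega⟩
          have hl' : l' + 1 ≤ j * m ^ k := by rw [add_mul] at hl; omega
          set d := m ^ k with hd
          have hw := pebbleCount_walked n c a l'
          have h1 : Reach n p (2 * l' + 1) c (walked c a l') :=
            reach_walked ha (fun i hi hi' => hc i hi (by omega)) (by omega) (by omega)
          have h2 : Reach n p ((2 * k * m + 2) * d) (walked c a l')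
              (cleared (walked c a l') (a + l' + 1) d) := by
            refine ih (by simp [walked]) (fun i hi hi' => ?_) (by omega) le_rfl (by omega)
            have := hc i (by omega) (by omega)
            simp only [walked]; grind
          set c2 := cleared (walked c a l') (a + l' + 1) d with hc2
          set c3 := Function.update c2 (a + l' + 1) .ghost with hc3
          have hc3c : ∀ i, c3 i = .pebble → c i = .pebble := by
            intro i h
            simp only [hc3, hc2, cleared, walked, Function.update_apply] at h
            grind
          have h3 : Reach n p 1 c2 c3 := by
            refine Reach.single (.ghost (a + l' + 1)) ⟨by omega, by omega, ?_⟩ rfl ?_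
            · simp [hc2, cleared, walked]
            · exact (pebbleCount_mono hc3c).trans (by omega)
          have h4 : Reach n p (2 * j * (l' + 1) + (2 * k * m + 2) * (l' + 1)) c3
              (cleared c3 a (l' + 1)) := by
            refine ihj (l' + 1) c3 ?_ (fun i hi hi' h => ?_) (by omega) hl' ?_
            · simp only [hc3, hc2, cleared, walked, Function.update_apply]; grind
            · exact hc i hi (by omega) (hc3c i h)
            · have := pebbleCount_mono (n := n) hc3c; omega
          have h5 : cleared c3 a (l' + 1) = cleared c a (l' + 1 + d) := by
            funext i
            simp only [hc3, hc2, cleared, walked, Function.update_apply]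
            grind
          rw [← h5]
          refine (((h1.trans h2).trans h3).trans h4).mono ?_
          -- Walking to the base and ghosting it cost 2(l' + 1) moves in all, so the claimed bound
          -- has a slack of 2(j + 1)d.
          have : 0 ≤ (j + 1) * d := Nat.zero_le _
          nlinarith
    exact (key m l c ha hc hn (by rwa [pow_succ'] at hl) (by omega)).mono
      (le_of_eq (by ring))

/-- One pebble rests on n after the walk, and clearing at level s needs s + 1 more. -/
lemma reach_pebbled {n s m : ℕ} (hn : 1 ≤ n) (hs : 1 ≤ s) (hm : n ≤ m ^ s) :
    Reach n (s + 2) ((2 * s * m + 4) * n) start (Function.update start n .pebble) := by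
  obtain ⟨l, rfl⟩ : ∃ l, n = l + 1 := ⟨n - 1, by omega⟩
  have h0 := pebbleCount_start (l + 1)
  have hw := pebbleCount_walked (l + 1) start 0 l
  have h1 : Reach (l + 1) (s + 2) (2 * l + 1) start (walked start 0 l) := by
    refine reach_walked (by simp [start]) (fun i hi _ => ?_) (by omega) (by omega)
    rw [start, Function.update_of_ne (by omega)]
    simp
  have h2 : Reach (l + 1) (s + 2) ((2 * s * m + 2) * l) (walked start 0 l)
      (cleared (walked start 0 l) 0 l) := by
    refine reach_cleared s ?_ (fun i hi hi' => ?_) (by omega) (by omega) (by omega)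
    · simp [walked, start]
    · simp only [walked]; grind
  have h3 : cleared (walked start 0 l) 0 l = Function.update start (l + 1) .pebble := by
    funext i
    simp only [cleared, walked, start, Function.update_apply]
    grind
  rw [← h3]
  exact (h1.trans h2).mono (by nlinarith)

lemma exists_play {n s : ℕ} (hn : 1 ≤ n) (hs : 1 ≤ s) :
    ∃ ms : List Move, Play n (s + 2) start ms ∧
      ms.foldl Move.apply start = Function.update start n .pebble ∧
      (ms.length : ℝ) ≤ 8 * s * (n : ℝ) ^ (1 + 1 / (s : ℝ)) := by
  have hn1 : (1 : ℝ) ≤ n := by exact_mod_cast hn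
  have hs1 : (1 : ℝ) ≤ s := by exact_mod_cast hs
  set u : ℝ := (n : ℝ) ^ (1 / (s : ℝ)) with hu
  have hu1 : 1 ≤ u := Real.one_le_rpow hn1 (by positivity)
  have hus : u ^ s = n := by
    rw [hu, one_div, Real.rpow_inv_natCast_pow (by positivity) (by omega)]
  have hm : n ≤ ⌈u⌉₊ ^ s := by
    have h : (n : ℝ) ≤ (⌈u⌉₊ : ℝ) ^ s := by
      rw [← hus]; exact pow_le_pow_left₀ (by positivity) (Nat.le_ceil u) s
    exact_mod_cast h
  obtain ⟨ms, h1, h2, h3⟩ := reach_pebbled hn hs hm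
  refine ⟨ms, h1, h2, ?_⟩
  have h3' : (ms.length : ℝ) ≤ (2 * s * ⌈u⌉₊ + 4) * n := by exact_mod_cast h3
  -- Rounding up costs a factor 2 since u ≥ 1. The additive 4 is absorbed into 4su, which gives the
  -- constant 4 + 4 = 8.
  have hmu : (⌈u⌉₊ : ℝ) ≤ 2 * u := by
    have := (Nat.ceil_lt_add_one (by positivity : 0 ≤ u)).le; linarith
  rw [Real.rpow_add (by positivity), Real.rpow_one, ← hu]
  have hsu : 1 ≤ s * u := one_le_mul_of_one_le_of_one_le hs1 hu1
  calc (ms.length : ℝ) ≤ (2 * s * ⌈u⌉₊ + 4) * n := h3'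
    _ ≤ (2 * s * (2 * u) + 4 * (s * u)) * n := by gcongr; linarith
    _ = 8 * s * (n * u) := by ring

lemma Play.spookyPebbles {n p : ℕ} {ms : List Move} (h : Play n p start ms)
    (hf : ms.foldl Move.apply start = Function.update start n .pebble) :
    SpookyPebbles n p ms := by
  obtain ⟨h1, h2⟩ := h.spookyPebbles_aux (by simp [pebbleCount_start])
  exact ⟨h1, by simpa [position] using hf, h2⟩


/-! ### Linearity of the runs of circuits -/

section Circuits

lemma ket_congr {W : Type} {y y' z z' : W → Bool} (h : y' = y ↔ z' = z) : ket y y' = ket z z' := by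
  by_cases hz : z' = z
  · rw [ket, ket, if_pos (h.2 hz), if_pos hz]
  · rw [ket, ket, if_neg (mt h.1 hz), if_neg hz]

variable {W B : Type} [DecidableEq W] [DecidableEq B]

lemma Circuit.run_append (ω : ℕ → Bool) (A A' : Circuit W B) (t : ℕ) (s : Branch W B) :
    Circuit.run ω t (A ++ A') s = Circuit.run ω (t + A.length) A' (Circuit.run ω t A s) := by
  induction A generalizing t s with
  | nil => rfl
  | cons op A ih =>
    simp only [List.cons_append, Circuit.run, ih, List.length_cons]
    congr 1
    omega

lemma Gate.exists_linear (g : Gate W) : ∃ L : QState W →ₗ[ℂ] QState W, ∀ ψ, g.apply ψ = L ψ := by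
  refine ⟨⟨⟨g.apply, ?_⟩, ?_⟩, fun ψ => rfl⟩
  · intro ψ φ
    funext y
    cases g <;> simp only [Gate.apply, Pi.add_apply] <;> ring
  · intro a ψ
    funext y
    cases g <;> simp only [Gate.apply, Pi.smul_apply, smul_eq_mul, RingHom.id_apply] <;> ring

/-- The control bits are determined by the initial bits and the outcomes alone, so within a branch
every controlled gate is either the gate or the identity, and a measurement is a projection. -/
lemma Circuit.exists_linear (ω : ℕ → Bool) (A : Circuit W B) (t : ℕ) (bits : B → Bool) :
    ∃ (bits' : B → Bool) (L : QState W →ₗ[ℂ] QState W),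
      ∀ ψ, Circuit.run ω t A ⟨ψ, bits⟩ = ⟨L ψ, bits'⟩ := by
  induction A generalizing t bits with
  | nil => exact ⟨bits, LinearMap.id, fun _ => rfl⟩
  | cons op A ih =>
    obtain ⟨bits1, L1, h1⟩ : ∃ (bits' : B → Bool) (L : QState W →ₗ[ℂ] QState W),
        ∀ ψ, op.exec (ω t) ⟨ψ, bits⟩ = ⟨L ψ, bits'⟩ := by
      cases op with
      | gate g =>
        obtain ⟨L, hL⟩ := g.exists_linear
        exact ⟨bits, L, fun ψ => by simp [Op.exec, hL]⟩
      | measure w b =>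
        refine ⟨Function.update bits b (ω t),
          ⟨⟨fun ψ y => if y w = ω t then ψ y else 0, ?_⟩, ?_⟩, fun ψ => rfl⟩
        · intro ψ φ
          funext y
          by_cases h : y w = ω t <;> simp [h]
        · intro a ψ
          funext y
          by_cases h : y w = ω t <;> simp [h]
      | control b g =>
        obtain ⟨L, hL⟩ := g.exists_linear
        by_cases hb : bits b
        · exact ⟨bits, L, fun ψ => by simp [Op.exec, hL, hb]⟩
        · exact ⟨bits, LinearMap.id, fun ψ => by simp [Op.exec, hb]⟩
    obtain ⟨bits2, L2, h2⟩ := ih (t + 1) bits1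
    exact ⟨bits2, L2 ∘ₗ L1, fun ψ => by simp [Circuit.run, h1, h2]⟩

/-- Reduction to basis states. The phase may vary with x but the final bits may not; `Nonempty` is
what ties `bits'` to the actual run. -/
lemma Circuit.run_sum {ι : Type} [Fintype ι] [Nonempty ι] {ω : ℕ → Bool} {A : Circuit W B} {t : ℕ}
    {bits bits' : B → Bool} {y y' : ι → W → Bool} {p : ι → ℂ}
    (h : ∀ x, Circuit.run ω t A ⟨ket (y x), bits⟩ = ⟨p x • ket (y' x), bits'⟩) (c : ι → ℂ) :
    Circuit.run ω t A ⟨∑ x, c x • ket (y x), bits⟩ = ⟨∑ x, (c x * p x) • ket (y' x), bits'⟩ := by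
  obtain ⟨b, L, hL⟩ := Circuit.exists_linear ω A t bits
  have h1 : ∀ x, L (ket (y x)) = p x • ket (y' x) ∧ b = bits' := by
    intro x
    have := (hL (ket (y x))).symm.trans (h x)
    simpa using this
  rw [hL, (h1 (Classical.arbitrary ι)).2]
  simp [map_sum, (h1 _).1, mul_smul]

/-! ### Classical reversible gates -/

/-- The permutation of the basis given by a classical gate. -/
def Gate.act : Gate W → (W → Bool) → (W → Bool)
  | .X t, y => Function.update y t (!y t)
  | .Z _, y => y
  | .H _, y => y
  | .CNOT c t _, y => Function.update y t (xor (y t) (y c))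
  | .CCNOT c d t _ _ _, y => Function.update y t (xor (y t) (y c && y d))

/-- The gate is classical and all its controls are in `R`. -/
def Gate.ReadsIn (R : W → Prop) : Gate W → Prop
  | .X _ => True
  | .Z _ => False
  | .H _ => False
  | .CNOT c _ _ => R c
  | .CCNOT c d _ _ _ _ => R c ∧ R d

/-- The action of a sequence of classical gates on the basis. -/
def actList (gs : List (Gate W)) (y : W → Bool) : W → Bool := gs.foldl (fun y g => g.act y) y

@[simp] lemma actList_nil (y : W → Bool) : actList [] y = y := rfl

@[simp] lemma actList_cons (g : Gate W) (gs : List (Gate W)) (y : W → Bool) :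
    actList (g :: gs) y = actList gs (g.act y) := rfl

@[simp] lemma actList_append (gs gs' : List (Gate W)) (y : W → Bool) :
    actList (gs ++ gs') y = actList gs' (actList gs y) := List.foldl_append

lemma Gate.act_act (g : Gate W) (y : W → Bool) : g.act (g.act y) = y := by
  funext w
  cases g with
  | X t => by_cases h : w = t <;> simp [Gate.act, h]
  | Z t => rfl
  | H t => rfl
  | CNOT c t hct =>
    by_cases h : w = t <;> simp [Gate.act, h, hct]
  | CCNOT c d t hcd hct hdt =>
    by_cases h : w = t <;> simp [Gate.act, h, hct, hdt]

lemma actList_reverse (gs : List (Gate W)) (y : W → Bool) :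
    actList gs.reverse (actList gs y) = y := by
  induction gs generalizing y with
  | nil => rfl
  | cons g gs ih => simp [ih, Gate.act_act]

lemma Gate.apply_ket {R : W → Prop} {g : Gate W} (hg : g.ReadsIn R) (y : W → Bool) :
    g.apply (ket y) = ket (g.act y) := by
  have h : ∀ y', g.apply (ket y) y' = ket y (g.act y') := by
    intro y'
    cases g <;> first | rfl | exact hg.elim
  funext y'
  rw [h]
  exact ket_congr
    ⟨fun e => by rw [← e, g.act_act], fun e => by rw [e, g.act_act]⟩

lemma Circuit.run_gates {R : W → Prop} {gs : List (Gate W)} (hg : ∀ g ∈ gs, g.ReadsIn R)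
    (ω : ℕ → Bool) (t : ℕ) (y : W → Bool) (bits : B → Bool) :
    Circuit.run ω t (gs.map Op.gate) ⟨ket y, bits⟩ = ⟨ket (actList gs y), bits⟩ := by
  induction gs generalizing t y with
  | nil => rfl
  | cons g gs ih =>
    simp only [List.map_cons, Circuit.run, Op.exec, Gate.apply_ket (hg g (by simp)), actList_cons]
    exact ih (fun g' h => hg g' (by simp [h])) _ _

/-- A change to wires that no gate reads passes through the gate untouched, even if the gate writes
to them. This is what lets a computation be undone after its result has been copied out. -/
lemma Gate.act_xor {R : W → Prop} {g : Gate W} (hg : g.ReadsIn R) {D : W → Bool}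
    (hD : ∀ w, R w → D w = false) (y : W → Bool) :
    g.act (fun w => xor (y w) (D w)) = fun w => xor (g.act y w) (D w) := by
  funext w
  cases g with
  | X t => by_cases h : w = t <;> simp [Gate.act, h]
  | Z t => exact hg.elim
  | H t => exact hg.elim
  | CNOT c t hct =>
    by_cases h : w = t
    · simp [Gate.act, h, hD c hg, Bool.xor_comm (y c)]
    · simp [Gate.act, h]
  | CCNOT c d t hcd hct hdt =>
    by_cases h : w = t
    · simp [Gate.act, h, hD c hg.1, hD d hg.2, Bool.xor_comm (y c && y d)]
    · simp [Gate.act, h]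

lemma actList_xor {R : W → Prop} {gs : List (Gate W)} (hg : ∀ g ∈ gs, g.ReadsIn R) {D : W → Bool}
    (hD : ∀ w, R w → D w = false) (y : W → Bool) :
    actList gs (fun w => xor (y w) (D w)) = fun w => xor (actList gs y w) (D w) := by
  induction gs generalizing y with
  | nil => rfl
  | cons g gs ih =>
    rw [actList_cons, Gate.act_xor (hg g (by simp)) hD, ih (fun g' h => hg g' (by simp [h]))]
    rfl

/-! ### Reversible execution of a program -/

lemma xorInto_append {gs gs' : List (Gate W)} {l r t : W} (hl : l ≠ t) (hr : r ≠ t)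
    {F F' : Bool → Bool → Bool}
    (h : ∀ y, actList gs y = Function.update y t (xor (y t) (F (y l) (y r))))
    (h' : ∀ y, actList gs' y = Function.update y t (xor (y t) (F' (y l) (y r)))) (y : W → Bool) :
    actList (gs ++ gs') y =
      Function.update y t (xor (y t) (xor (F (y l) (y r)) (F' (y l) (y r)))) := by
  simp [h, h', hl, hr]

lemma exists_xorInto_const (R : W → Prop) (l r t : W) (b : Bool) :
    ∃ gs : List (Gate W), (∀ g ∈ gs, g.ReadsIn R) ∧ gs.length ≤ 1 ∧
      ∀ y, actList gs y = Function.update y t (xor (y t) ((fun _ _ => b) (y l) (y r))) := by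
  cases b
  · exact ⟨[], by simp, by simp, fun y => by simp⟩
  · exact ⟨[.X t], by simp [Gate.ReadsIn], by simp, fun y => by simp [Gate.act]⟩

lemma exists_xorInto_and {R : W → Prop} {l r t : W} (hl : l ≠ t) (hr : r ≠ t) (hRl : R l)
    (hRr : R r) (b : Bool) :
    ∃ gs : List (Gate W), (∀ g ∈ gs, g.ReadsIn R) ∧ gs.length ≤ 1 ∧
      ∀ y, actList gs y = Function.update y t (xor (y t) (b && (y l && y r))) := by
  cases b
  · exact ⟨[], by simp, by simp, fun y => by simp⟩
  · by_cases h : l = r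
    · subst h
      exact ⟨[.CNOT l t hl], by simp [Gate.ReadsIn, hRl], by simp, fun y => by simp [Gate.act]⟩
    · exact ⟨[.CCNOT l r t h hl hr], by simp [Gate.ReadsIn, hRl, hRr], by simp,
        fun y => by simp [Gate.act]⟩

/-- Algebraic normal form: every Boolean function of two bits is c₀ ⊕ c₁u ⊕ c₂v ⊕ c₃uv, and each
term costs at most one gate. -/
lemma exists_gates_op {R : W → Prop} {l r t : W} (hl : l ≠ t) (hr : r ≠ t) (hRl : R l)
    (hRr : R r) (op : Bool → Bool → Bool) :
    ∃ gs : List (Gate W), (∀ g ∈ gs, g.ReadsIn R) ∧ gs.length ≤ 4 ∧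
      ∀ y, y t = false → actList gs y = Function.update y t (op (y l) (y r)) := by
  obtain ⟨g0, a0, b0, c0⟩ := exists_xorInto_const R l r t (op false false)
  obtain ⟨g1, a1, b1, c1⟩ :=
    exists_xorInto_and hl hl hRl hRl (xor (op false false) (op true false))
  obtain ⟨g2, a2, b2, c2⟩ :=
    exists_xorInto_and hr hr hRr hRr (xor (op false false) (op false true))
  obtain ⟨g3, a3, b3, c3⟩ := exists_xorInto_and hl hr hRl hRr
    (xor (xor (op false false) (op true false)) (xor (op false true) (op true true)))
  have h1 := xorInto_append hl hr (F := fun _ _ => op false false) c0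
    (F' := fun u _ => xor (op false false) (op true false) && (u && u)) c1
  have h2 := xorInto_append hl hr
    (F := fun u v => xor (op false false) (xor (op false false) (op true false) && (u && u))) h1
    (F' := fun _ v => xor (op false false) (op false true) && (v && v)) c2
  have h3 := xorInto_append hl hr (F := fun u v =>
      xor (xor (op false false) (xor (op false false) (op true false) && (u && u)))
        (xor (op false false) (op false true) && (v && v))) h2
    (F' := fun u v => xor (xor (op false false) (op true false))
      (xor (op false true) (op true true)) && (u && v)) c3
  refine ⟨g0 ++ g1 ++ g2 ++ g3, ?_, by simp; omega, fun y hy => ?_⟩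
  · intro g hg
    simp only [List.mem_append] at hg
    rcases hg with ((hg | hg) | hg) | hg
    exacts [a0 g hg, a1 g hg, a2 g hg, a3 g hg]
  · rw [h3, hy]
    congr 1
    cases y l <;> cases y r <;> cases op false false <;> cases op false true <;>
      cases op true false <;> cases op true true <;> rfl

/-- Overwriting is avoided: each step writes its result to a fresh zero wire, and the memory cell is
redirected there. Hence one fresh wire per step, and `loc'` records where the cells end up. -/
lemma exists_gates_program {q S : ℕ} {R : W → Prop} {inp : Fin q → W} (hRi : ∀ i, R (inp i))
    (cs : List (Instr q S)) {ws : List W} {loc : Fin S → W} (hws : ws.Nodup)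
    (hRw : ∀ w ∈ ws, R w) (hRl : ∀ k, R (loc k)) (hl : ∀ k, loc k ∉ ws) (hi : ∀ i, inp i ∉ ws)
    (hlen : cs.length ≤ ws.length) :
    ∃ (gs : List (Gate W)) (loc' : Fin S → W), (∀ g ∈ gs, g.ReadsIn R) ∧
      gs.length ≤ 4 * cs.length ∧ (∀ k, R (loc' k)) ∧ ∀ y, (∀ w ∈ ws, y w = false) →
        (fun k => actList gs y (loc' k)) =
          cs.foldl (fun mem c => c.exec (fun i => y (inp i)) mem) (fun k => y (loc k)) := by
  induction cs generalizing ws loc with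
  | nil => exact ⟨[], loc, by simp, by simp, hRl, fun y _ => rfl⟩
  | cons c cs ih =>
    cases ws with
    | nil => simp at hlen
    | cons w ws =>
      have hmem : ∀ u : Fin q ⊕ Fin S, Sum.elim inp loc u ≠ w ∧ R (Sum.elim inp loc u) := by
        rintro (i | k)
        · exact ⟨fun h => hi i (by simp [← h]), hRi i⟩
        · exact ⟨fun h => hl k (by simp [← h]), hRl k⟩
      obtain ⟨g0, a0, b0, c0⟩ := exists_gates_op (hmem c.left).1 (hmem c.right).1
        (hmem c.left).2 (hmem c.right).2 c.op
      rw [List.nodup_cons] at hws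
      obtain ⟨g1, loc', a1, b1, d1, c1⟩ := ih (ws := ws) (loc := Function.update loc c.target w)
        hws.2 (fun v hv => hRw v (by simp [hv]))
        (fun k => by
          by_cases h : k = c.target
          · subst h; simpa using hRw w (by simp)
          · simpa [h] using hRl k)
        (fun k => by
          by_cases h : k = c.target
          · subst h; simpa using hws.1
          · have := hl k
            simp only [List.mem_cons, not_or] at this
            simpa [h] using this.2)
        (fun i h => hi i (by simp [h])) (by simpa using hlen)
      refine ⟨g0 ++ g1, loc', ?_, by simp; omega, d1, fun y hy => ?_⟩
      · intro g hg
        rcases List.mem_append.1 hg with hg | hg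
        exacts [a0 g hg, a1 g hg]
      · have hyw := c0 y (hy w (by simp))
        have he : ∀ u, y (Sum.elim inp loc u) =
            Sum.elim (fun i => y (inp i)) (fun k => y (loc k)) u := by
          rintro (i | k) <;> rfl
        rw [actList_append, hyw, c1, List.foldl_cons]
        · congr 1
          · funext mem c'
            congr 1
            funext i
            exact Function.update_of_ne (hmem (.inl i)).1 _ _
          · funext k
            simp only [Instr.exec]
            by_cases h : k = c.target
            · subst h; simp [he]
            · simp only [Function.update_of_ne h]
              exact Function.update_of_ne (hmem (.inr k)).1 _ _
        · intro v hv
          rw [Function.update_of_ne (fun h => hws.1 (by rwa [← h]))]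
          exact hy v (by simp [hv])

lemma actList_copy {S : ℕ} {src dst : Fin S → W} (hdst : Function.Injective dst)
    (hsd : ∀ k k', src k ≠ dst k') (ks : List (Fin S)) (hks : ks.Nodup) (y : W → Bool) :
    actList (ks.map fun k => Gate.CNOT (src k) (dst k) (hsd k k)) y =
      fun w => xor (y w) (decide (∃ k ∈ ks, dst k = w ∧ y (src k) = true)) := by
  induction ks generalizing y with
  | nil => simp
  | cons k ks ih =>
    rw [List.nodup_cons] at hks
    rw [List.map_cons, actList_cons, ih hks.2]
    funext w
    have hs : ∀ k', (Gate.CNOT (src k) (dst k) (hsd k k)).act y (src k') = y (src k') :=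
      fun k' => Function.update_of_ne (hsd k' k) _ _
    simp only [hs]
    by_cases h : w = dst k
    · subst h
      have h1 : ¬ ∃ k' ∈ ks, dst k' = dst k ∧ y (src k') = true := by
        rintro ⟨k', hk', he, -⟩
        exact hks.1 (hdst he ▸ hk')
      have h2 : (∃ k' ∈ k :: ks, dst k' = dst k ∧ y (src k') = true) ↔ y (src k) = true := by
        constructor
        · rintro ⟨k', -, he, hy⟩
          exact hdst he ▸ hy
        · exact fun hy => ⟨k, by simp, rfl, hy⟩
      simp only [h1, h2]
      simp [Gate.act]
    · have h2 : (∃ k' ∈ k :: ks, dst k' = w ∧ y (src k') = true) ↔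
          ∃ k' ∈ ks, dst k' = w ∧ y (src k') = true := by
        simp only [List.exists_mem_cons_iff]
        exact or_iff_right fun h' => h h'.1.symm
      simp only [h2, Gate.act, Function.update_of_ne h]

open Classical in
-- Compute, copy, uncompute: at most 4S + S + 4S gates. The final memory may lie partly in `loc` and
-- partly in scratch; both are disjoint from `dst`, so the copy does not disturb the reversal. The
-- predicate `P` selects the cells that are copied.
lemma exists_gates_xor {q S : ℕ} {inp : Fin q → W} {loc sc dst : Fin S → W}
    (hdst : Function.Injective dst) (hsc : Function.Injective sc)
    (hil : ∀ i k, inp i ≠ sc k) (hid : ∀ i k, inp i ≠ dst k) (hls : ∀ k k', loc k ≠ sc k')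
    (hld : ∀ k k', loc k ≠ dst k') (hsd : ∀ k k', sc k ≠ dst k')
    (cs : List (Instr q S)) (hcs : cs.length ≤ S) (P : Fin S → Prop) :
    ∃ (R : W → Prop) (gs : List (Gate W)), (∀ g ∈ gs, g.ReadsIn R) ∧ gs.length ≤ 9 * S ∧
      ∀ y, (∀ k, y (sc k) = false) → actList gs y = fun w => xor (y w) (decide (∃ k, dst k = w ∧
        (cs.foldl (fun mem c => c.exec (fun i => y (inp i)) mem) (fun k => y (loc k)) k &&
          decide (P k)) = true)) := by
  -- The readable wires are those outside the target register, so the copied bits cannot influence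
  -- the reversed computation.
  set R : W → Prop := fun w => ∀ k, w ≠ dst k with hR
  obtain ⟨gs, loc', h1, h2, h3, h4⟩ := exists_gates_program (R := R) (inp := inp) hid cs
    (ws := (List.finRange S).map sc) (loc := loc) ((List.nodup_finRange S).map hsc)
    (by simpa [hR] using hsd) hld (by simpa using fun k k' => (hls k k').symm)
    (by simpa using fun i k => (hil i k).symm) (by simpa using hcs)
  have hsub : ((List.finRange S).filter fun k => decide (P k)).length ≤ S := by
    simpa using List.length_filter_le (fun k => decide (P k)) (List.finRange S)
  set cp : List (Gate W) := ((List.finRange S).filter fun k => decide (P k)).map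
    fun k => Gate.CNOT (loc' k) (dst k) (h3 k k) with hcp
  refine ⟨R, gs ++ cp ++ gs.reverse, ?_, ?_, fun y hy => ?_⟩
  · intro g hg
    simp only [List.mem_append, List.mem_reverse] at hg
    rcases hg with (hg | hg) | hg
    · exact h1 g hg
    · obtain ⟨k, -, rfl⟩ := List.mem_map.1 hg
      exact h3 k
    · exact h1 g hg
  · simp only [hcp, List.length_append, List.length_map, List.length_reverse]
    omega
  · have h5 := h4 y (by simpa using hy)
    rw [actList_append, actList_append, hcp,
      actList_copy hdst h3 _ ((List.nodup_finRange S).filter _),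
      actList_xor (R := R) (by simpa using h1), actList_reverse]
    · rw [← h5]
      funext w
      congr 1
      rw [decide_eq_decide]
      simp only [List.mem_filter, List.mem_finRange, true_and, decide_eq_true_eq, Bool.and_eq_true]
      exact exists_congr fun k => by tauto
    · intro w hw
      rw [decide_eq_false_iff_not]
      rintro ⟨k, -, rfl, -⟩
      exact hw k rfl

/-! ### Measurement-based uncomputation -/

lemma Circuit.run_controlZ {S : ℕ} (creg : Fin S → B) (dst : Fin S → W) (ks : List (Fin S))
    (ω : ℕ → Bool) (t : ℕ) (y : W → Bool) (bits : B → Bool) (p : ℂ) :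
    Circuit.run ω t (ks.map fun k => Op.control (creg k) (.Z (dst k))) ⟨p • ket y, bits⟩ =
      ⟨(p * (ks.map fun k => if bits (creg k) && y (dst k) then (-1 : ℂ) else 1).prod) • ket y,
        bits⟩ := by
  induction ks generalizing t p with
  | nil => simp [Circuit.run]
  | cons k ks ih =>
    have h : Op.exec (ω t) (Op.control (creg k) (.Z (dst k))) ⟨p • ket y, bits⟩ =
        ⟨(p * if bits (creg k) && y (dst k) then (-1 : ℂ) else 1) • ket y, bits⟩ := by
      simp only [Op.exec, Branch.mk.injEq, and_true]
      funext y'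
      by_cases hy : y' = y
      · subst hy
        cases bits (creg k) <;> cases h : y' (dst k) <;> simp [Gate.apply, ket, h]
      · cases bits (creg k) <;> simp [Gate.apply, ket, hy]
    simp only [List.map_cons, Circuit.run, h, ih, List.prod_cons, mul_assoc]

/-- Measurement of a qubit in the Hadamard basis, after which the qubit is reset. -/
def measureX (w : W) (b : B) : Circuit W B :=
  [.gate (.H w), .measure w b, .control b (.X w)]

/-- The number e indicates whether y and y' agree off w. With it, identities that involve only the
wire w reduce to a check of Boolean cases. -/
lemma exists_ket_update (y y' : W → Bool) (w : W) : ∃ e : ℂ,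
    (∀ b, ket y (Function.update y' w b) = if b = y w then e else 0) ∧
    ∀ b, ket (Function.update y w b) y' = if y' w = b then e else 0 := by
  refine ⟨ket (Function.update y w false) (Function.update y' w false), fun b => ?_, fun b => ?_⟩
  · split_ifs with hb
    · exact ket_congr (by simp +contextual [Function.update_eq_iff, hb])
    · rw [ket, if_neg (fun h => hb (by simp [← h]))]
  · split_ifs with hb
    · exact ket_congr (by simp +contextual [Function.eq_update_iff, hb])
    · rw [ket, if_neg (fun h => hb (by simp [h]))]

/-- The Hadamard gate gives outcome o the amplitude (-1)^(o·y w)/√2, and the controlled X resets the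
qubit. The measurement is the second of the three operations, hence ω (t + 1). -/
lemma run_measureX (w : W) (b : B) (ω : ℕ → Bool) (t : ℕ) (y : W → Bool) (bits : B → Bool)
    (p : ℂ) :
    Circuit.run ω t (measureX w b) ⟨p • ket y, bits⟩ =
      ⟨(((1 / √2 : ℝ) : ℂ) * p * if ω (t + 1) && y w then (-1 : ℂ) else 1) •
        ket (Function.update y w false), Function.update bits b (ω (t + 1))⟩ := by
  simp only [measureX, Circuit.run, Op.exec, Branch.mk.injEq, and_true, Function.update_self]
  funext y'
  obtain ⟨e, he, he'⟩ := exists_ket_update y y' w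
  cases ω (t + 1) <;> cases h : y w <;> cases h' : y' w <;>
    simp [Gate.apply, he, he', h, h', mul_assoc]

/-- The new bits are chosen before p and y: they are the same for every basis state, as
superposition requires. -/
lemma run_measureX_register {S : ℕ} {creg : Fin S → B} {dst : Fin S → W}
    (hc : Function.Injective creg) (hd : Function.Injective dst) (ks : List (Fin S))
    (hks : ks.Nodup) (ω : ℕ → Bool) (t : ℕ) (bits : B → Bool) :
    ∃ bits' : B → Bool, (∀ b, (∀ k ∈ ks, creg k ≠ b) → bits' b = bits b) ∧ ∀ (p : ℂ) (y : W → Bool),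
      Circuit.run ω t (ks.flatMap fun k => measureX (dst k) (creg k)) ⟨p • ket y, bits⟩ =
        ⟨(((1 / √2 : ℝ) : ℂ) ^ ks.length * p *
            (ks.map fun k => if bits' (creg k) && y (dst k) then (-1 : ℂ) else 1).prod) •
          ket (fun w => y w && decide (¬ ∃ k ∈ ks, dst k = w)), bits'⟩ := by
  induction ks generalizing t bits with
  | nil => exact ⟨bits, fun _ _ => rfl, fun p y => by simp [Circuit.run]⟩
  | cons k ks ih =>
    rw [List.nodup_cons] at hks
    obtain ⟨bits', h1, h2⟩ := ih hks.2 (t + 3) (Function.update bits (creg k) (ω (t + 1)))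
    have hk : bits' (creg k) = ω (t + 1) := by
      rw [h1 _ fun k' hk' h => hks.1 (by rwa [← hc h]), Function.update_self]
    refine ⟨bits', fun b hb => ?_, fun p y => ?_⟩
    · rw [h1 b fun k' hk' => hb k' (by simp [hk']),
        Function.update_of_ne (hb k (by simp)).symm]
    · rw [List.flatMap_cons, Circuit.run_append, run_measureX]
      rw [show (measureX (dst k) (creg k)).length = 3 from rfl, h2]
      congr 1
      have h3 : ∀ k' ∈ ks, Function.update y (dst k) false (dst k') = y (dst k') :=
        fun k' hk' => Function.update_of_ne (fun h => hks.1 (by rwa [← hd h])) _ _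
      have h4 : (ks.map fun k' => if bits' (creg k') && Function.update y (dst k) false (dst k')
          then (-1 : ℂ) else 1) =
          ks.map fun k' => if bits' (creg k') && y (dst k') then (-1 : ℂ) else 1 :=
        List.map_congr_left fun k' hk' => by rw [h3 k' hk']
      rw [h4, List.map_cons, List.prod_cons, hk, List.length_cons, pow_succ]
      congr 1
      · ring
      · congr 1
        funext w
        by_cases hw : w = dst k
        · subst hw; simp
        · have : ¬ dst k = w := fun h => hw h.symm
          simp [hw, this]

end Circuits


/-! ### Registers -/

/-- The `k`-th qubit of the `v`-th of `m` registers of `S` qubits. -/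
def wire {m S : ℕ} (v : Fin m) (k : Fin S) : Fin (m * S) := finProdFinEquiv (v, k)

lemma wire_inj {m S : ℕ} {v v' : Fin m} {k k' : Fin S} :
    wire v k = wire v' k' ↔ v = v' ∧ k = k' := by
  simp [wire]

lemma exists_wire {m S : ℕ} (w : Fin (m * S)) : ∃ (v : Fin m) (k : Fin S), w = wire v k :=
  ⟨(finProdFinEquiv.symm w).1, (finProdFinEquiv.symm w).2, (finProdFinEquiv.apply_symm_apply w).symm⟩

/-- An assignment of registers to the vertices such that different pebbled vertices have different
registers, none of which is the register `0`. -/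
structure Coloring {m : ℕ} [NeZero m] (n : ℕ) (c : ℕ → Cell) (col : ℕ → Fin m) : Prop where
  pebble_zero : c 0 = .pebble
  ne_zero : ∀ i ≤ n, c i = .pebble → col i ≠ 0
  inj : ∀ i ≤ n, ∀ i' ≤ n, c i = .pebble → c i' = .pebble → col i = col i' → i = i'

section Registers

variable {q r S n m : ℕ} [NeZero m] {B : Type} [DecidableEq B]
  {prog : Program q S} {out : Fin r ↪ Fin S} {c c' : ℕ → Cell} {col col' : ℕ → Fin m}

lemma Coloring.of_subset (h : Coloring n c col) (h0 : c' 0 = .pebble)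
    (hc : ∀ i, c' i = .pebble → c i = .pebble) : Coloring n c' col :=
  ⟨h0, fun i hi hp => h.ne_zero i hi (hc i hp),
    fun i hi i' hi' hp hp' => h.inj i hi i' hi' (hc i hp) (hc i' hp')⟩

lemma Coloring.place {i : ℕ} {v : Fin m} (h : Coloring n c col) (hv : v ≠ 0)
    (hv' : ∀ i' ≤ n, c i' = .pebble → col i' ≠ v) :
    Coloring n (Function.update c i .pebble) (Function.update col i v) := by
  refine ⟨?_, fun j hj hp => ?_, fun j hj j' hj' hp hp' he => ?_⟩
  · by_cases h0 : 0 = i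
    · simp [h0]
    · simpa [h0] using h.pebble_zero
  · by_cases hji : j = i
    · subst hji; simpa using hv
    · simp only [Function.update_of_ne hji] at hp ⊢
      exact h.ne_zero j hj hp
  · by_cases hji : j = i <;> by_cases hji' : j' = i
    · rw [hji, hji']
    · subst hji
      simp only [Function.update_of_ne hji', Function.update_self] at hp' he
      exact (hv' j' hj' hp' he.symm).elim
    · subst hji'
      simp only [Function.update_of_ne hji, Function.update_self] at hp he
      exact (hv' j hj hp he).elim
    · simp only [Function.update_of_ne hji, Function.update_of_ne hji'] at hp hp' he
      exact h.inj j hj j' hj' hp hp' he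

/-- Besides the pebbled vertices, two registers are taken: the scratch register 0 and the register
of vertex 0, which stays zero and supplies the initial memory. -/
lemma exists_free_register (c : ℕ → Cell) (col : ℕ → Fin m) (hm : pebbleCount n c + 2 < m) :
    ∃ v : Fin m, v ≠ 0 ∧ ∀ i ≤ n, c i = .pebble → col i ≠ v := by
  classical
  set used : Finset (Fin m) :=
    insert 0 (insert (col 0) (((Finset.Icc 1 n).filter (fun i => c i = .pebble)).image col))
  have hcard : used.card < (Finset.univ : Finset (Fin m)).card := by
    rw [Finset.card_univ, Fintype.card_fin]
    refine lt_of_le_of_lt ?_ hm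
    refine (Finset.card_insert_le _ _).trans (Nat.succ_le_succ ?_)
    exact (Finset.card_insert_le _ _).trans (Nat.succ_le_succ Finset.card_image_le)
  obtain ⟨v, -, hv⟩ := Finset.exists_mem_notMem_of_card_lt_card hcard
  simp only [used, Finset.mem_insert, Finset.mem_image, Finset.mem_filter, Finset.mem_Icc,
    not_or, not_exists] at hv
  refine ⟨v, hv.1, fun i hi hp he => ?_⟩
  rcases Nat.eq_zero_or_pos i with rfl | h0
  · exact hv.2.1 he.symm
  · exact hv.2.2 i ⟨⟨⟨h0, hi⟩, hp⟩, he⟩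

/-! ### The basis states of a position -/

/-- The basis state of a position in which the vertex `i` is held in the register `col i`. -/
noncomputable def positionBits (prog : Program q S) (out : Fin r ↪ Fin S) (n : ℕ) (c : ℕ → Cell) (col : ℕ → Fin m) (x : Fin q → Bool) :
    Fin q ⊕ Fin (m * S) → Bool :=
  pebbledBits prog out n c (fun i => wire (col i)) x

omit [NeZero m] in
@[simp] lemma positionBits_inl (x : Fin q → Bool) (i : Fin q) :
    positionBits prog out n c col x (.inl i) = x i := rfl

omit [NeZero m] in
open Classical in
lemma positionBits_wire (x : Fin q → Bool) (v : Fin m) (k : Fin S) :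
    positionBits prog out n c col x (.inr (wire v k)) =
      decide (∃ i, 1 ≤ i ∧ i ≤ n ∧ c i = .pebble ∧ col i = v ∧
        vertexValue prog out n i x k = true) := by
  simp only [positionBits, pebbledBits, Sum.elim_inr]
  rw [decide_eq_decide]
  refine exists_congr fun i => ⟨?_, ?_⟩
  · rintro ⟨k', h1, h2, h3, h4, h5⟩
    obtain ⟨h6, rfl⟩ := wire_inj.1 h4
    exact ⟨h1, h2, h3, h6, h5⟩
  · rintro ⟨h1, h2, h3, rfl, h5⟩
    exact ⟨k, h1, h2, h3, rfl, h5⟩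

omit [NeZero m] in
lemma vertexValue_zero (x : Fin q → Bool) (k : Fin S) :
    vertexValue prog out n 0 x k = false := by
  simp [vertexValue, Program.memory]

lemma Coloring.positionBits_wire (h : Coloring n c col) {i : ℕ} (hi : i ≤ n)
    (hp : c i = .pebble) (x : Fin q → Bool) (k : Fin S) :
    positionBits prog out n c col x (.inr (wire (col i) k)) = vertexValue prog out n i x k := by
  classical
  rw [SpookySim.positionBits_wire, Bool.eq_iff_iff, decide_eq_true_eq]
  constructor
  · rintro ⟨i', h1, h2, h3, h4, h5⟩
    rwa [← h.inj i' h2 i hi h3 hp h4]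
  · intro hv
    rcases Nat.eq_zero_or_pos i with rfl | h0
    · rw [vertexValue_zero] at hv; cases hv
    · exact ⟨i, h0, hi, hp, rfl, hv⟩

lemma Coloring.positionBits_wire_zero (h : Coloring n c col) (x : Fin q → Bool) (k : Fin S) :
    positionBits prog out n c col x (.inr (wire 0 k)) = false := by
  rw [SpookySim.positionBits_wire, decide_eq_false_iff_not]
  rintro ⟨i, -, h2, h3, h4, -⟩
  exact h.ne_zero i h2 h3 h4

omit [NeZero m] in
-- Placing is written as an XOR with the value of the vertex, so that the same identity read
-- backwards describes removal.
open Classical in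
lemma positionBits_place {i : ℕ} {v : Fin m} (hi : 1 ≤ i) (hin : i ≤ n) (hc : c i ≠ .pebble)
    (hv : ∀ i' ≤ n, c i' = .pebble → col i' ≠ v) (x : Fin q → Bool) :
    positionBits prog out n (Function.update c i .pebble) (Function.update col i v) x =
      fun w => xor (positionBits prog out n c col x w)
        (decide (∃ k, Sum.inr (wire v k) = w ∧ vertexValue prog out n i x k = true)) := by
  funext w
  rcases w with j | w
  · simp
  obtain ⟨v', k, rfl⟩ := exists_wire w
  rw [positionBits_wire, positionBits_wire]
  simp only [Sum.inr.injEq, wire_inj]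
  by_cases hvv : v' = v
  · subst hvv
    have h1 : ¬ ∃ i', 1 ≤ i' ∧ i' ≤ n ∧ c i' = .pebble ∧ col i' = v' ∧
        vertexValue prog out n i' x k = true := by
      rintro ⟨i', -, h2, h3, h4, -⟩
      exact hv i' h2 h3 h4
    simp only [h1, decide_false, Bool.false_xor]
    rw [decide_eq_decide]
    constructor
    · rintro ⟨i', h1', h2, h3, h4, h5⟩
      by_cases hii : i' = i
      · subst hii; exact ⟨k, ⟨trivial, rfl⟩, h5⟩
      · rw [Function.update_of_ne hii] at h3 h4
        exact (h1 ⟨i', h1', h2, h3, h4, h5⟩).elim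
    · rintro ⟨k', ⟨-, rfl⟩, h5⟩
      exact ⟨i, hi, hin, by simp, by simp, h5⟩
  · have h1 : ¬ ∃ k', (v = v' ∧ k' = k) ∧ vertexValue prog out n i x k' = true := by
      rintro ⟨k', ⟨h2, -⟩, -⟩
      exact hvv h2.symm
    simp only [h1, decide_false, Bool.xor_false]
    rw [decide_eq_decide]
    refine exists_congr fun i' => ?_
    by_cases hii : i' = i
    · subst hii
      simp [hc, Ne.symm hvv]
    · simp [hii]

open Classical in
lemma Coloring.positionBits_ghost (h : Coloring n c col) {i : ℕ} (hin : i ≤ n)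
    (hc : c i = .pebble) (x : Fin q → Bool) :
    positionBits prog out n (Function.update c i .ghost) col x =
      fun w => positionBits prog out n c col x w &&
        decide (¬ ∃ k ∈ List.finRange S, Sum.inr (wire (col i) k) = w) := by
  funext w
  rcases w with j | w
  · simp
  obtain ⟨v, k, rfl⟩ := exists_wire w
  simp only [Sum.inr.injEq, wire_inj, List.mem_finRange, true_and]
  rw [SpookySim.positionBits_wire, SpookySim.positionBits_wire, Bool.eq_iff_iff]
  simp only [Bool.and_eq_true, decide_eq_true_eq]
  constructor
  · rintro ⟨i', h1, h2, h3, h4, h5⟩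
    have hii : i' ≠ i := by rintro rfl; simp at h3
    rw [Function.update_of_ne hii] at h3
    refine ⟨⟨i', h1, h2, h3, h4, h5⟩, ?_⟩
    rintro ⟨k', h6, -⟩
    exact hii (h.inj i' h2 i hin h3 hc (h4.trans h6.symm))
  · rintro ⟨⟨i', h1, h2, h3, h4, h5⟩, h6⟩
    have hii : i' ≠ i := by rintro rfl; exact h6 ⟨k, h4, rfl⟩
    exact ⟨i', h1, h2, by rwa [Function.update_of_ne hii], h4, h5⟩

/-! ### The phases of a position -/

/-- The phase of a position is a factor independent of the vertex `i` times the phase of `i`. -/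
lemma exists_ghostPhase_eq {b : ℕ} (prog : Program q S) (out : Fin r ↪ Fin S)
    (creg : ℕ → Fin S → Fin b) (c : ℕ → Cell) (bits : Fin b → Bool) (x : Fin q → Bool) {i : ℕ}
    (hi : 1 ≤ i) (hin : i ≤ n) :
    ∃ g : ℂ, ∀ (c' : ℕ → Cell) (bits' : Fin b → Bool), (∀ i', i' ≠ i → c' i' = c i') →
      (∀ i' k, 1 ≤ i' → i' ≤ n → i' ≠ i → bits' (creg i' k) = bits (creg i' k)) →
      ghostPhase prog out n c' creg bits' x = g * if c' i = .ghost then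
        ((List.finRange S).map fun k => if bits' (creg i k) && vertexValue prog out n i x k
          then (-1 : ℂ) else 1).prod else 1 := by
  refine ⟨∏ i' ∈ (Finset.Icc 1 n).erase i, if c i' = .ghost then ∏ k : Fin S,
    (if bits (creg i' k) && vertexValue prog out n i' x k then (-1 : ℂ) else 1) else 1,
    fun c' bits' hc hb => ?_⟩
  rw [ghostPhase, Finset.prod_filter,
    ← Finset.prod_erase_mul (Finset.Icc 1 n) _ (Finset.mem_Icc.2 ⟨hi, hin⟩)]
  congr 1
  refine Finset.prod_congr rfl fun i' hi' => ?_
  obtain ⟨hne, hmem⟩ := Finset.mem_erase.1 hi'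
  obtain ⟨h1, h2⟩ := Finset.mem_Icc.1 hmem
  rw [hc i' hne]
  simp only [hb i' _ h1 h2 hne]

lemma prod_sign_mul_self {S : ℕ} (p : Fin S → Bool) (ks : List (Fin S)) :
    (ks.map fun k => if p k then (-1 : ℂ) else 1).prod *
      (ks.map fun k => if p k then (-1 : ℂ) else 1).prod = 1 := by
  rw [← List.prod_map_mul]
  refine List.prod_eq_one fun z hz => ?_
  obtain ⟨k, -, rfl⟩ := List.mem_map.1 hz
  cases p k <;> simp

/-! ### Circuits for the moves -/

/-- The circuit takes the state of one position to that of another, for all measured bits of the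
ghosts. -/
def Implements {b : ℕ} (prog : Program q S) (out : Fin r ↪ Fin S) (n : ℕ)
    (creg : ℕ → Fin S → Fin b) (c : ℕ → Cell) (col : ℕ → Fin m) (c' : ℕ → Cell) (col' : ℕ → Fin m)
    (A : Circuit (Fin q ⊕ Fin (m * S)) (Fin b)) : Prop :=
  ∀ (ω : ℕ → Bool) (t : ℕ) (bits : Fin b → Bool), ∃ (z : ℂ) (bits' : Fin b → Bool),
    ∀ α : (Fin q → Bool) → ℂ,
      Circuit.run ω t A ⟨∑ x, (α x * ghostPhase prog out n c creg bits x) •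
          ket (positionBits prog out n c col x), bits⟩ =
        ⟨z • ∑ x, (α x * ghostPhase prog out n c' creg bits' x) •
          ket (positionBits prog out n c' col' x), bits'⟩

variable {b : ℕ} {creg : ℕ → Fin S → Fin b}

omit [NeZero m] in
lemma Implements.refl : Implements prog out n creg c col c col [] :=
  fun _ _ bits => ⟨1, bits, fun _ => by simp [Circuit.run]⟩

omit [NeZero m] in
lemma Implements.append {c'' : ℕ → Cell} {col'' : ℕ → Fin m}
    {A A' : Circuit (Fin q ⊕ Fin (m * S)) (Fin b)}
    (h : Implements prog out n creg c col c' col' A)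
    (h' : Implements prog out n creg c' col' c'' col'' A') :
    Implements prog out n creg c col c'' col'' (A ++ A') := by
  intro ω t bits
  obtain ⟨z, bits1, h1⟩ := h ω t bits
  obtain ⟨z', bits2, h2⟩ := h' ω (t + A.length) bits1
  refine ⟨z * z', bits2, fun α => ?_⟩
  -- The scalar of the first circuit is absorbed into the amplitudes, which the second circuit
  -- allows to be arbitrary.
  have h3 := h2 fun x => z * α x
  rw [Circuit.run_append, h1, Finset.smul_sum]
  simp only [smul_smul, ← mul_assoc] at h3 ⊢
  rw [h3, Finset.smul_sum, Finset.smul_sum]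
  congr 1
  refine Finset.sum_congr rfl fun x _ => ?_
  rw [smul_smul, smul_smul]
  congr 1
  ring

-- Register 0 is the scratch space, and the piece of the program between vertices i - 1 and i starts
-- from the register of vertex i - 1.
open Classical in
lemma exists_gates_vertex (h : Coloring n c col) {i : ℕ} (hi : 1 ≤ i) (hin : i ≤ n)
    (hp : c (i - 1) = .pebble) {v : Fin m} (hv : v ≠ 0) (hv' : v ≠ col (i - 1)) :
    ∃ (R : Fin q ⊕ Fin (m * S) → Prop) (gs : List (Gate (Fin q ⊕ Fin (m * S)))),
      (∀ g ∈ gs, g.ReadsIn R) ∧ gs.length ≤ 9 * S ∧ ∀ x,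
        actList gs (positionBits prog out n c col x) =
          fun w => xor (positionBits prog out n c col x w)
            (decide (∃ k, Sum.inr (wire v k) = w ∧ vertexValue prog out n i x k = true)) := by
  obtain ⟨R, gs, h1, h2, h3⟩ := exists_gates_xor (q := q) (W := Fin q ⊕ Fin (m * S))
    (inp := Sum.inl) (loc := fun k => .inr (wire (col (i - 1)) k)) (sc := fun k => .inr (wire 0 k))
    (dst := fun k => .inr (wire v k)) (fun k k' he => by simpa [wire_inj] using he)
    (fun k k' he => by simpa [wire_inj] using he) (by simp) (by simp)
    (by intro k k'; simpa [wire_inj] using fun he => (h.ne_zero (i - 1) (by omega) hp he).elim)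
    (by intro k k'; simpa [wire_inj] using fun he => (hv' (Eq.symm he)).elim)
    (by intro k k'; simpa [wire_inj] using fun he => (hv (Eq.symm he)).elim)
    ((prog.drop ((i - 1) * S)).take S) (by simp) (fun k => i = n → ∃ j, out j = k)
  refine ⟨R, gs, h1, h2, fun x => ?_⟩
  rw [h3 _ fun k => h.positionBits_wire_zero x k]
  have hval : ((prog.drop ((i - 1) * S)).take S).foldl
      (fun mem c' => c'.exec (fun j => positionBits prog out n c col x (.inl j)) mem)
      (fun k => positionBits prog out n c col x (.inr (wire (col (i - 1)) k))) =
      Program.memory (prog.take (i * S)) x := by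
    have h4 : (fun k => positionBits prog out n c col x (.inr (wire (col (i - 1)) k))) =
        Program.memory (prog.take ((i - 1) * S)) x := by
      funext k
      rw [h.positionBits_wire (by omega) hp, vertexValue]
      -- The preceding vertex is never the last one, so it holds the full memory and not just the
      -- output cells.
      have : i - 1 ≠ n := by omega
      simp [this]
    have h5 : i * S = (i - 1) * S + S := by
      conv_lhs => rw [← Nat.sub_add_cancel hi, add_mul, one_mul]
    rw [h4, h5, List.take_add, Program.memory, Program.memory, List.foldl_append]
    rfl
  rw [hval]
  funext w
  congr 1
  rw [decide_eq_decide]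
  refine exists_congr fun k => and_congr_right fun _ => ?_
  simp only [vertexValue, Bool.and_eq_true, decide_eq_true_eq]

lemma exists_implements_remove (h : Coloring n c col) {i : ℕ} (hi : 1 ≤ i) (hin : i ≤ n)
    (hc : c i = .pebble) (hp : c (i - 1) = .pebble) :
    ∃ A : Circuit (Fin q ⊕ Fin (m * S)) (Fin b), A.length ≤ 10 * S ∧
      Implements prog out n creg c col (Function.update c i .empty) col A := by
  classical
  obtain ⟨R, gs, h1, h2, h3⟩ := exists_gates_vertex (prog := prog) (out := out) h hi hin hp
    (h.ne_zero i hin hc) (fun he => by have := h.inj _ hin _ (by omega) hc hp he; omega)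
  refine ⟨gs.map Op.gate, by simp; omega, fun ω t bits => ⟨1, bits, fun α => ?_⟩⟩
  have hb : ∀ x, actList gs (positionBits prog out n c col x) =
      positionBits prog out n (Function.update c i .empty) col x := by
    intro x
    -- Removal undoes a placement: the position with i emptied, followed by placing i in the same
    -- register, is the present one, and the two XORs cancel.
    have h4 := positionBits_place (prog := prog) (out := out) (c := Function.update c i .empty)
      (col := col) (v := col i) hi hin (by simp) (fun i' hi' hp' he => by
        have hne : i' ≠ i := by rintro rfl; simp at hp'
        rw [Function.update_of_ne hne] at hp'
        exact hne (h.inj i' hi' i hin hp' hc he)) x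
    rw [Function.update_idem, Function.update_eq_self, ← hc, Function.update_eq_self] at h4
    rw [h3, h4]
    funext w
    rw [Bool.xor_assoc, Bool.xor_self, Bool.xor_false]
  have hg : ∀ x, ghostPhase prog out n (Function.update c i .empty) creg bits x =
      ghostPhase prog out n c creg bits x := by
    intro x
    obtain ⟨g, h5⟩ := exists_ghostPhase_eq prog out creg c bits x hi hin
    rw [h5 _ bits (fun i' hi' => Function.update_of_ne hi' _ _) (fun _ _ _ _ _ => rfl),
      h5 c bits (fun _ _ => rfl) (fun _ _ _ _ _ => rfl)]
    simp [hc]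
  rw [Circuit.run_sum (p := 1) (y' := fun x => actList gs (positionBits prog out n c col x))
    (bits' := bits) (fun x => by rw [Circuit.run_gates h1]; simp)]
  simp [hb, hg]

lemma exists_implements_place (h : Coloring n c col) {i : ℕ} (hi : 1 ≤ i) (hin : i ≤ n)
    (hc : c i ≠ .pebble) (hp : c (i - 1) = .pebble) {v : Fin m} (hv : v ≠ 0)
    (hv' : ∀ i' ≤ n, c i' = .pebble → col i' ≠ v) :
    ∃ A : Circuit (Fin q ⊕ Fin (m * S)) (Fin b), A.length ≤ 10 * S ∧
      Implements prog out n creg c col (Function.update c i .pebble) (Function.update col i v)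
        A := by
  classical
  obtain ⟨R, gs, h1, h2, h3⟩ := exists_gates_vertex (prog := prog) (out := out) h hi hin hp
    hv (hv' (i - 1) (by omega) hp).symm
  have hb : ∀ x, actList gs (positionBits prog out n c col x) =
      positionBits prog out n (Function.update c i .pebble) (Function.update col i v) x :=
    fun x => by rw [h3, positionBits_place hi hin hc hv']
  have hval : ∀ x k, positionBits prog out n (Function.update c i .pebble)
      (Function.update col i v) x (.inr (wire v k)) = vertexValue prog out n i x k := by
    intro x k
    have h4 := (h.place (i := i) hv hv').positionBits_wire (prog := prog) (out := out)
      hin (by simp) x k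
    rwa [Function.update_self] at h4
  -- On a ghost, the recomputed value drives Z gates controlled by the stored bits β. They repeat
  -- the sign (-1)^(β·v), and the two copies multiply to 1. This adds S gates to the 9S.
  by_cases hgh : c i = .ghost
  · refine ⟨gs.map Op.gate ++ (List.finRange S).map
      fun k => Op.control (creg i k) (.Z (.inr (wire v k))), by simp; omega,
      fun ω t bits => ⟨1, bits, fun α => ?_⟩⟩
    have hrun : ∀ x, Circuit.run ω t (gs.map Op.gate ++ (List.finRange S).map
        fun k => Op.control (creg i k) (.Z (.inr (wire v k))))
        ⟨ket (positionBits prog out n c col x), bits⟩ =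
        ⟨((List.finRange S).map fun k => if bits (creg i k) && vertexValue prog out n i x k
          then (-1 : ℂ) else 1).prod • ket (positionBits prog out n (Function.update c i .pebble)
            (Function.update col i v) x), bits⟩ := by
      intro x
      rw [Circuit.run_append, Circuit.run_gates h1, hb]
      have h5 := Circuit.run_controlZ (creg i) (fun k => Sum.inr (wire v k)) (List.finRange S) ω
        (t + (gs.map (Op.gate (B := Fin b))).length)
        (positionBits prog out n (Function.update c i .pebble) (Function.update col i v) x) bits 1
      simpa only [one_smul, one_mul, hval] using h5
    rw [Circuit.run_sum hrun, one_smul]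
    congr 1
    refine Finset.sum_congr rfl fun x _ => ?_
    obtain ⟨g, h5⟩ := exists_ghostPhase_eq prog out creg c bits x hi hin
    rw [h5 (Function.update c i .pebble) bits (fun i' hi' => Function.update_of_ne hi' _ _)
        (fun _ _ _ _ _ => rfl),
      h5 c bits (fun _ _ => rfl) (fun _ _ _ _ _ => rfl), if_pos hgh, if_neg (by simp),
      mul_assoc, mul_assoc g, prod_sign_mul_self]
  · refine ⟨gs.map Op.gate, by simp; omega, fun ω t bits => ⟨1, bits, fun α => ?_⟩⟩
    have hg : ∀ x, ghostPhase prog out n (Function.update c i .pebble) creg bits x =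
        ghostPhase prog out n c creg bits x := by
      intro x
      obtain ⟨g, h5⟩ := exists_ghostPhase_eq prog out creg c bits x hi hin
      rw [h5 _ bits (fun i' hi' => Function.update_of_ne hi' _ _) (fun _ _ _ _ _ => rfl),
        h5 c bits (fun _ _ => rfl) (fun _ _ _ _ _ => rfl)]
      simp [hgh]
    rw [Circuit.run_sum (p := 1) (y' := fun x => actList gs (positionBits prog out n c col x))
      (bits' := bits) (fun x => by rw [Circuit.run_gates h1]; simp)]
    simp [hb, hg]

lemma exists_implements_ghost (h : Coloring n c col) {i : ℕ} (hi : 1 ≤ i) (hin : i ≤ n)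
    (hc : c i = .pebble) (hcreg : ∀ i i' k k', 1 ≤ i → i ≤ n → 1 ≤ i' → i' ≤ n →
      creg i k = creg i' k' → i = i' ∧ k = k') :
    ∃ A : Circuit (Fin q ⊕ Fin (m * S)) (Fin b), A.length ≤ 10 * S ∧
      Implements prog out n creg c col (Function.update c i .ghost) col A := by
  classical
  refine ⟨(List.finRange S).flatMap fun k => measureX (.inr (wire (col i) k)) (creg i k),
    ?_, fun ω t bits => ?_⟩
  · simp [List.length_flatMap, measureX]
    omega
  · obtain ⟨bits', h1, h2⟩ := run_measureX_register (creg := creg i)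
      (dst := fun k => (Sum.inr (wire (col i) k) : Fin q ⊕ Fin (m * S)))
      (fun k k' he => (hcreg i i k k' hi hin hi hin he).2)
      (fun k k' he => by simpa [wire_inj] using he) (List.finRange S) (List.nodup_finRange S)
      ω t bits
    -- One factor 1/√2 for each measured qubit, whatever the outcome.
    refine ⟨((1 / √2 : ℝ) : ℂ) ^ S, bits', fun α => ?_⟩
    have hrun := fun x => h2 1 (positionBits prog out n c col x)
    simp only [one_smul] at hrun
    rw [Circuit.run_sum hrun, Finset.smul_sum]
    congr 1
    refine Finset.sum_congr rfl fun x _ => ?_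
    obtain ⟨g, h5⟩ := exists_ghostPhase_eq prog out creg c bits x hi hin
    rw [h5 (Function.update c i .ghost) bits' (fun i' hi' => Function.update_of_ne hi' _ _)
        -- The phases of the other ghosts survive because their classical registers are disjoint
        -- from that of i.
        (fun i' k h6 h7 h8 => h1 _ fun k' _ he => h8 (hcreg i' i k k' h6 h7 hi hin he.symm).1),
      h5 c bits (fun _ _ => rfl) (fun _ _ _ _ _ => rfl), smul_smul,
      h.positionBits_ghost hin hc]
    simp only [h.positionBits_wire hin hc, hc, Function.update_self, if_true,
      List.length_finRange, reduceCtorEq, if_false]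
    congr 1
    ring

/-! ### Circuits for a sequence of moves -/

lemma exists_implements_move {p : ℕ} (hm : p + 2 < m) (h : Coloring n c col)
    (hcount : pebbleCount n c ≤ p) (hcreg : ∀ i i' k k', 1 ≤ i → i ≤ n → 1 ≤ i' → i' ≤ n →
      creg i k = creg i' k' → i = i' ∧ k = k') {mv : Move} (hmv : mv.Legal n c) :
    ∃ (col' : ℕ → Fin m) (A : Circuit (Fin q ⊕ Fin (m * S)) (Fin b)),
      Coloring n (mv.apply c) col' ∧ A.length ≤ 10 * S ∧
        Implements prog out n creg c col (mv.apply c) col' A := by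
  have hsub : ∀ (i : ℕ) (d : Cell), d ≠ .pebble → 1 ≤ i →
      Coloring n (Function.update c i d) col := by
    intro i d hd hi
    refine h.of_subset (by rw [Function.update_of_ne (by omega), h.pebble_zero]) fun i' hi' => ?_
    by_cases hii : i' = i
    · subst hii; simp [hd] at hi'
    · rwa [Function.update_of_ne hii] at hi'
  cases mv with
  | ghost i =>
    obtain ⟨h1, h2, h3⟩ := hmv
    obtain ⟨A, hA, hA'⟩ := exists_implements_ghost (prog := prog) (out := out) h h1 h2 h3 hcreg
    exact ⟨col, A, hsub i _ (by simp) h1, hA, hA'⟩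
  | place i =>
    obtain ⟨h1, h2, h3, h4⟩ := hmv
    obtain ⟨v, hv, hv'⟩ := exists_free_register (n := n) c col (by omega)
    obtain ⟨A, hA, hA'⟩ := exists_implements_place (prog := prog) (out := out) (creg := creg)
      h h1 h2 h3 h4 hv hv'
    exact ⟨Function.update col i v, A, h.place hv hv', hA, hA'⟩
  | remove i =>
    obtain ⟨h1, h2, h3, h4⟩ := hmv
    obtain ⟨A, hA, hA'⟩ := exists_implements_remove (prog := prog) (out := out) (creg := creg)
      h h1 h2 h3 h4
    exact ⟨col, A, hsub i _ (by simp) h1, hA, hA'⟩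

lemma exists_blocks {p : ℕ} (prog : Program q S) (out : Fin r ↪ Fin S) (hm : p + 2 < m)
    (hcreg : ∀ i i' k k', 1 ≤ i → i ≤ n → 1 ≤ i' → i' ≤ n →
      creg i k = creg i' k' → i = i' ∧ k = k') {ms : List Move} (h : Coloring n c col)
    (hcount : pebbleCount n c ≤ p) (hplay : Play n p c ms) :
    ∃ (blocks : List (Circuit (Fin q ⊕ Fin (m * S)) (Fin b))) (cols : ℕ → ℕ → Fin m),
      blocks.length = ms.length ∧ blocks.flatten.length ≤ 10 * S * ms.length ∧
      ∀ j ≤ ms.length, Coloring n ((ms.take j).foldl Move.apply c) (cols j) ∧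
        Implements prog out n creg c col ((ms.take j).foldl Move.apply c) (cols j)
          (blocks.take j).flatten := by
  induction ms generalizing c col with
  | nil => exact ⟨[], fun _ => col, rfl, by simp, fun j _ => by simpa using ⟨h, Implements.refl⟩⟩
  | cons mv ms ih =>
    obtain ⟨col', A, h1, h2, h3⟩ := exists_implements_move (prog := prog) (out := out) hm h hcount
      hcreg hplay.1
    obtain ⟨blocks, cols, h4, h5, h6⟩ := ih h1 hplay.2.1 hplay.2.2
    refine ⟨A :: blocks, fun j => Nat.casesOn j col cols, by simp [h4], ?_, ?_⟩
    · simp only [List.flatten_cons, List.length_append, List.length_cons]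
      linarith
    · rintro (_ | j) hj
      · exact ⟨h, Implements.refl⟩
      · obtain ⟨h7, h8⟩ := h6 j (by simpa using hj)
        exact ⟨h7, by simpa using h3.append h8⟩

end Registers


/-! ### The whole circuit -/

section Assembly

variable {q r S n m : ℕ} {prog : Program q S} {out : Fin r ↪ Fin S}

lemma ghostPhase_eq_one {b : ℕ} {c : ℕ → Cell} (hc : ∀ i, c i ≠ .ghost)
    (creg : ℕ → Fin S → Fin b) (bits : Fin b → Bool) (x : Fin q → Bool) :
    ghostPhase prog out n c creg bits x = 1 := by
  rw [ghostPhase, Finset.filter_false_of_mem fun i _ => hc i, Finset.prod_empty]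

lemma start_ne_ghost (i : ℕ) : start i ≠ .ghost := by
  by_cases h : i = 0 <;> simp [start, h]

lemma start_eq_pebble_iff {i : ℕ} : start i = .pebble ↔ i = 0 := by
  by_cases h : i = 0 <;> simp [start, h]

lemma positionBits_start (col : ℕ → Fin m) (x : Fin q → Bool) :
    positionBits prog out n start col x = Sum.elim x fun _ => false := by
  classical
  funext w
  rcases w with j | w
  · rfl
  obtain ⟨v, k, rfl⟩ := exists_wire w
  rw [positionBits_wire, Sum.elim_inr, decide_eq_false_iff_not]
  rintro ⟨i, h1, -, h3, -⟩
  rw [start_eq_pebble_iff] at h3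
  omega

lemma positionBits_final (hn : 1 ≤ n) (hprog : prog.length ≤ n * S)
    {f : (Fin q → Bool) → (Fin r → Bool)} (hf : prog.Computes out f) (col : ℕ → Fin m)
    (x : Fin q → Bool) :
    positionBits prog out n (Function.update start n .pebble) col x =
      Sum.elim x fun w => decide (∃ j, wire (col n) (out j) = w ∧ f x j = true) := by
  classical
  funext w
  rcases w with j | w
  · rfl
  obtain ⟨v, k, rfl⟩ := exists_wire w
  rw [positionBits_wire, Sum.elim_inr, decide_eq_decide]
  simp only [vertexValue, wire_inj, Bool.and_eq_true, decide_eq_true_eq]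
  constructor
  · rintro ⟨i, h1, -, h3, h4, h5, h6⟩
    have hi : i = n := by
      by_contra hne
      rw [Function.update_of_ne hne, start_eq_pebble_iff] at h3
      omega
    subst hi
    obtain ⟨j, rfl⟩ := h6 rfl
    rw [List.take_of_length_le hprog, hf] at h5
    exact ⟨j, ⟨h4, rfl⟩, h5⟩
  · rintro ⟨j, ⟨h1, rfl⟩, h2⟩
    refine ⟨n, hn, le_rfl, by simp, h1, ?_, fun _ => ⟨j, rfl⟩⟩
    rw [List.take_of_length_le hprog, hf, h2]

/-- Classical registers of `S` bits for the vertices `1, …, n`. -/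
lemma exists_classical_registers (hn : 1 ≤ n) :
    ∃ creg : ℕ → Fin S → Fin (n * S), ∀ i i' k k', 1 ≤ i → i ≤ n → 1 ≤ i' → i' ≤ n →
      creg i k = creg i' k' → i = i' ∧ k = k' := by
  -- Vertices 1, …, n are shifted to 0, …, n - 1; the remainder only makes the assignment total.
  refine ⟨fun i k => wire ⟨(i - 1) % n, Nat.mod_lt _ hn⟩ k, fun i i' k k' h1 h2 h3 h4 he => ?_⟩
  obtain ⟨h5, h6⟩ := wire_inj.1 he
  rw [Fin.mk.injEq, Nat.mod_eq_of_lt (by omega), Nat.mod_eq_of_lt (by omega)] at h5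
  exact ⟨by omega, h6⟩

theorem exists_circuit {p : ℕ} {ms : List Move} (hn : 1 ≤ n) (hplay : Play n p start ms)
    (hfin : ms.foldl Move.apply start = Function.update start n .pebble)
    (hprog : prog.length ≤ n * S) {f : (Fin q → Bool) → (Fin r → Bool)}
    (hf : prog.Computes out f) :
    ∃ blocks : List (Circuit (Fin q ⊕ Fin ((p + 3) * S)) (Fin (n * S))),
      CarriesOut blocks prog out n ms ∧ Simulates blocks.flatten f ∧
        blocks.flatten.length ≤ 10 * S * ms.length := by
  obtain ⟨creg, hcreg⟩ := exists_classical_registers (S := S) hn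
  -- A constant assignment suffices at the start, since only vertex 0 is pebbled; the value 1 avoids
  -- the scratch register.
  have h0 : Coloring n start (fun _ => (1 : Fin (p + 3))) := by
    refine ⟨by simp [start], fun _ _ _ => by simp, fun i _ i' _ h h' _ => ?_⟩
    rw [start_eq_pebble_iff] at h h'
    rw [h, h']
  obtain ⟨blocks, cols, h1, h2, h3⟩ := exists_blocks prog out (by omega : p + 2 < p + 3) hcreg h0
    (by simp [pebbleCount_start]) hplay
  have hinit : ∀ α : (Fin q → Bool) → ℂ,
      (initial α : Branch (Fin q ⊕ Fin ((p + 3) * S)) (Fin (n * S))) =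
      ⟨∑ x, (α x * ghostPhase prog out n start creg (fun _ => false) x) •
        ket (positionBits prog out n start (fun _ => (1 : Fin (p + 3))) x), fun _ => false⟩ := by
    intro α
    simp only [initial, ghostPhase_eq_one start_ne_ghost, positionBits_start, mul_one]
  refine ⟨blocks, ⟨h1, fun j i => wire (cols j i), creg, fun j hj => ⟨?_, fun ω => ?_⟩⟩, ?_, h2⟩
  · intro i i' k k' _ hi _ hi' hp hp' he
    obtain ⟨h4, h5⟩ := wire_inj.1 he
    exact ⟨(h3 j hj).1.inj i hi i' hi' hp hp' h4, h5⟩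
  · obtain ⟨z, bits', h4⟩ := (h3 j hj).2 ω 0 fun _ => false
    refine ⟨z, fun α => ?_⟩
    rw [hinit, h4]
    rfl
  · refine ⟨⟨fun j => wire (cols ms.length n) (out j), fun j j' he =>
      out.injective (wire_inj.1 he).2⟩, fun ω => ?_⟩
    obtain ⟨z, bits', h4⟩ := (h3 ms.length le_rfl).2 ω 0 fun _ => false
    refine ⟨z, fun α => ?_⟩
    rw [← h1, List.take_length, h1, List.take_length, hfin] at h4
    have hg : ∀ i, Function.update start n .pebble i ≠ .ghost := by
      intro i
      by_cases hi : i = n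
      · simp [hi]
      · rw [Function.update_of_ne hi]; exact start_ne_ghost i
    rw [hinit, h4]
    simp only [ghostPhase_eq_one hg, mul_one, positionBits_final hn hprog hf]
    rfl

/-! ### Arithmetic of the resource bounds -/

lemma ceilDiv_bounds {S T : ℕ} (hS : 1 ≤ S) (hST : S ≤ T) :
    1 ≤ T ⌈/⌉ S ∧ T ≤ (T ⌈/⌉ S) * S ∧ (T ⌈/⌉ S) * S ≤ 2 * T := by
  have h1 : T ≤ (T ⌈/⌉ S) * S := by
    have := (ceilDiv_le_iff_le_mul (α := ℕ) (by omega : 0 < S) (b := T) (c := T ⌈/⌉ S)).1 le_rfl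
    rwa [mul_comm] at this
  refine ⟨?_, h1, ?_⟩
  · by_contra h
    have : T ⌈/⌉ S = 0 := by omega
    rw [this, zero_mul] at h1
    omega
  · have : (T ⌈/⌉ S) * S ≤ T + S - 1 := by
      rw [Nat.ceilDiv_eq_add_pred_div]
      exact Nat.div_mul_le_self _ _
    omega

/-- The bound on the number of gates in terms of the running time and the space. -/
lemma gate_bound {ε S T n s : ℝ} (hε : 0 < ε) (hε1 : ε < 1) (hS : 0 < S) (hST : S ≤ T)
    (hn : 1 ≤ n) (hnS : n * S ≤ 2 * T) (hs : 1 / ε ≤ s) (hs2 : s ≤ 2 * (1 / ε)) :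
    10 * S * (8 * s * n ^ (1 + 1 / s)) ≤ 640 * (1 / ε) * (T ^ (1 + ε) / S ^ ε) := by
  have hT : 0 < T := hS.trans_le hST
  have hs0 : 0 < s := lt_of_lt_of_le (by positivity) hs
  have h1 : 1 / s ≤ ε := by rwa [div_le_comm₀ hs0 hε]
  have h2 : n ≤ 2 * (T / S) := by rw [← mul_div_assoc, le_div_iff₀ hS]; exact hnS
  have h3 : n ^ (1 + 1 / s) ≤ 4 * (T / S) ^ (1 + ε) := by
    calc n ^ (1 + 1 / s) ≤ n ^ (1 + ε) := Real.rpow_le_rpow_of_exponent_le hn (by linarith)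
      _ ≤ (2 * (T / S)) ^ (1 + ε) := Real.rpow_le_rpow (by linarith) h2 (by linarith)
      _ = 2 ^ (1 + ε) * (T / S) ^ (1 + ε) := Real.mul_rpow (by norm_num) (by positivity)
      _ ≤ 4 * (T / S) ^ (1 + ε) := by
        gcongr
        calc (2 : ℝ) ^ (1 + ε) ≤ 2 ^ (2 : ℝ) :=
              Real.rpow_le_rpow_of_exponent_le (by norm_num) (by linarith)
          _ = 4 := by norm_num
  have h4 : S * (T / S) ^ (1 + ε) = T ^ (1 + ε) / S ^ ε := by
    rw [Real.div_rpow hT.le hS.le, Real.rpow_add hS, Real.rpow_one]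
    field_simp
  -- The constant is 640 = 10 · 8 · 2 · 4: gates per move, moves, rounding of 1/ε, and rounding of
  -- T/S.
  calc 10 * S * (8 * s * n ^ (1 + 1 / s))
      ≤ 10 * S * (8 * (2 * (1 / ε)) * (4 * (T / S) ^ (1 + ε))) := by gcongr
    _ = 640 * (1 / ε) * (S * (T / S) ^ (1 + ε)) := by ring
    _ = _ := by rw [h4]

end Assembly

end SpookySim

theorem mainTheorem3 :
    ∃ C : ℝ, 0 < C ∧ ∀ ε : ℝ, 0 < ε → ε < 1 →
      ∃ alg : ℕ → List SpookySim.Move,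
        (∀ n : ℕ, 1 ≤ n →
          SpookySim.SpookyPebbles n (⌈1 / ε⌉₊ + 2) (alg n) ∧
          ((alg n).length : ℝ) ≤ C * ⌈1 / ε⌉₊ * (n : ℝ) ^ (1 + 1 / (⌈1 / ε⌉₊ : ℝ))) ∧
        ∀ (q r T S : ℕ) (f : (Fin q → Bool) → (Fin r → Bool))
          (prog : SpookySim.Program q S) (out : Fin r ↪ Fin S),
          1 ≤ S → S ≤ T → prog.length ≤ T → prog.Computes out f →
          ∃ (a b : ℕ) (blocks : List (SpookySim.Circuit (Fin q ⊕ Fin a) (Fin b))),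
            SpookySim.CarriesOut blocks prog out (T ⌈/⌉ S) (alg (T ⌈/⌉ S)) ∧
            SpookySim.Simulates blocks.flatten f ∧
            (blocks.flatten.length : ℝ) ≤ C * (1 / ε) * ((T : ℝ) ^ (1 + ε) / (S : ℝ) ^ ε) ∧
            (a : ℝ) ≤ C * (1 / ε) * S ∧
            (b : ℝ) ≤ C * T := by
  refine ⟨640, by norm_num, fun ε hε hε1 => ?_⟩
  have hε' : 1 < 1 / ε := by rwa [lt_div_iff₀ hε, one_mul]
  set s := ⌈1 / ε⌉₊ with hs
  have hs1 : 1 ≤ s := Nat.one_le_ceil_iff.2 (by linarith)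
  have hsle : 1 / ε ≤ s := Nat.le_ceil _
  have hs2 : (s : ℝ) ≤ 2 * (1 / ε) := by
    have := (Nat.ceil_lt_add_one (by linarith : 0 ≤ 1 / ε)).le
    linarith
  -- The pebblings depend only on n and s and are fixed before any program is given; `alg 0` is a
  -- default value without significance.
  choose! alg halg using fun (n : ℕ) (hn : 1 ≤ n) => SpookySim.exists_play hn hs1
  refine ⟨alg, fun n hn => ?_, fun q r T S f prog out hS hST hprog hf => ?_⟩
  · obtain ⟨h1, h2, h3⟩ := halg n hn
    refine ⟨h1.spookyPebbles h2, h3.trans ?_⟩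
    gcongr
    norm_num
  · obtain ⟨hn, hT, hT2⟩ := SpookySim.ceilDiv_bounds hS hST
    obtain ⟨h1, h2, h3⟩ := halg (T ⌈/⌉ S) hn
    obtain ⟨blocks, hb1, hb2, hb3⟩ := SpookySim.exists_circuit hn h1 h2 (hprog.trans hT) hf
    have hT2' : ((T ⌈/⌉ S : ℕ) : ℝ) * S ≤ 2 * T := by exact_mod_cast hT2
    refine ⟨_, _, blocks, hb1, hb2, ?_, ?_, ?_⟩
    · have hb3' : (blocks.flatten.length : ℝ) ≤ 10 * S * (alg (T ⌈/⌉ S)).length := by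
        exact_mod_cast hb3
      refine hb3'.trans (le_trans (by gcongr) (SpookySim.gate_bound hε hε1 (by exact_mod_cast hS)
        (by exact_mod_cast hST) (n := (T ⌈/⌉ S : ℕ)) (by exact_mod_cast hn) hT2' hsle hs2))
    · push_cast
      -- The p + 3 registers with p = s + 2.
      have : (s : ℝ) + 2 + 3 ≤ 640 * (1 / ε) := by linarith
      gcongr
    · push_cast
      have : (0 : ℝ) ≤ T := by positivity
      linarith
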